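/- Let $N\ge 2$, $S=\{1,\dots,N+1\}$, and let $p_1,\dots,p_{N+1}\in\mathbb{R}^N$ be the vertices of a nondegenerate $N$-simplex $\tilde K$. Put $V_0=\{p_1,\dots,p_{N+1}\}$ and $\psi_i(z)=(z+p_i)/2$. For a word $w=w_1\cdots w_m\in S^m$ $(m\ge 0)$ let $\psi_w=\psi_{w_1}\circ\cdots\circ\psi_{w_m}$ and $|w|=m$. Write $W_*$ for the set of all words. The $N$-dimensional Sierpinski gasket is $K=\bigcap_{m\ge0}\bigcup_{|w|=m}\psi_w(\tilde K)$; put $K_w=\psi_w(K)$ and $V_*=\bigcup_{w\in W_*}\psi_w(V_0)$. For $f\in C(K)$ let $$\mathcal E(f,f)=\lim_{m\to\infty}\Big(\frac{N+3}{N+1}\Big)^m\sum_{|w|=m}\frac12\sum_{i,j\in S}\big(f(\psi_w(p_i))-f(\psi_w(p_j))\big)^2\in[0,\infty]$$ (the limit of a nondecreasing sequence), let $\mathcal F=\{f\in C(K):\mathcal E(f,f)<\infty\}$, and extend $\mathcal E$ to a bilinear form on $\mathcal F$ by polarization. The energy measure $\nu_f$ of $f\in\mathcal F$ is the unique finite Borel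 measure on $K$ with $\int_K g\,\mathrm d\nu_f=2\mathcal E(f,fg)-\mathcal E(f^2,g)$ for all $g\in\mathcal F$. A function $h\in\mathcal F$ is harmonic if it minimizes $\mathcal E(f,f)$ among all $f\in\mathcal F$ with $f|_{V_0}=h|_{V_0}$. Let $h_k$ $(k\in S)$ be the harmonic function with $h_k(p_k)=1$ and $h_k(p_i)=0$ for $i\neq k$, and let $\nu=\sum_{k\in S}\nu_{h_k}$ be the Kusuoka measure. **Theorem.** Let $h$ be a harmonic function. Then $\nu(K_w)>0$ for every $w\in W_*$, and there is a unique function $\frac{\delta\nu_h}{\delta\nu}\colon V_*\to\mathbb{R}$ such that $$\frac{\delta\nu_h}{\delta\nu}(x)=\lim_{n\to\infty}\frac{\nu_h(K_{wij^n})}{\nu(K_{wij^n})}\qquad\text{whenever } x=\psi_{wi}(p_j),\ w\in W_*,\ i,j\in S,$$ where $wij^n$ is the word $w$ followed by the letter $i$ and then $n$ letters $j$; in particular, these limits exist and depend only on $x$. Moreover, for every $w\in W_*$ and all distinct $i,j\in S$, the restriction of $\frac{\delta\nu_h}{\delta\nu}$ to $\psi_w(\overline{p_ip_j})\cap V_*$,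 where $\overline{p_ip_j}$ is the line segment from $p_i$ to $p_j$, is Hölder continuous with exponent $\log_2(1+N^{-1})$. -/

import Mathlib

open Filter Topology MeasureTheory
open scoped ENNReal NNReal

namespace Gasket

noncomputable section

/-- The contraction `ψ_i(z) = (z + p_i) / 2`. -/
def contraction {N : ℕ} (p : Fin (N + 1) → EuclideanSpace ℝ (Fin N)) (i : Fin (N + 1))
    (z : EuclideanSpace ℝ (Fin N)) : EuclideanSpace ℝ (Fin N) :=
  (2⁻¹ : ℝ) • (z + p i)

/-- `ψ_w = ψ_{w_1} ∘ ⋯ ∘ ψ_{w_m}` for a word `w = w_1 ⋯ w_m`; words are lists of letters. -/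
def wordMap {N : ℕ} (p : Fin (N + 1) → EuclideanSpace ℝ (Fin N)) :
    List (Fin (N + 1)) → EuclideanSpace ℝ (Fin N) → EuclideanSpace ℝ (Fin N)
  | [] => id
  | i :: w => contraction p i ∘ wordMap p w

/-- The gasket `K = ⋂_m ⋃_{w ∈ W_m} ψ_w(K̃)`, where `K̃` is the simplex with vertices `p_i`. -/
def gasket {N : ℕ} (p : Fin (N + 1) → EuclideanSpace ℝ (Fin N)) :
    Set (EuclideanSpace ℝ (Fin N)) :=
  ⋂ m : ℕ, ⋃ (w : List (Fin (N + 1))) (_ : w.length = m),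
    wordMap p w '' convexHull ℝ (Set.range p)

theorem contraction_vertex {N : ℕ} (p : Fin (N + 1) → EuclideanSpace ℝ (Fin N))
    (i : Fin (N + 1)) : contraction p i (p i) = p i := by
  unfold contraction
  rw [← two_smul ℝ (p i), smul_smul]
  norm_num

theorem vertex_mem_gasket {N : ℕ} (p : Fin (N + 1) → EuclideanSpace ℝ (Fin N))
    (i : Fin (N + 1)) : p i ∈ gasket p := by
  simp only [gasket, Set.mem_iInter, Set.mem_iUnion]
  intro m
  refine ⟨List.replicate m i, List.length_replicate, p i,
    subset_convexHull ℝ _ (Set.mem_range_self i), ?_⟩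
  induction m with
  | zero => rfl
  | succ m ih =>
    change contraction p i (wordMap p (List.replicate m i) (p i)) = p i
    rw [ih, contraction_vertex]

theorem contraction_mem_gasket {N : ℕ} (p : Fin (N + 1) → EuclideanSpace ℝ (Fin N))
    (i : Fin (N + 1)) {z : EuclideanSpace ℝ (Fin N)} (hz : z ∈ gasket p) :
    contraction p i z ∈ gasket p := by
  simp only [gasket, Set.mem_iInter, Set.mem_iUnion] at hz ⊢
  intro m
  cases m with
  | zero =>
    obtain ⟨w, hw, y, hy, rfl⟩ := hz 0
    obtain rfl := List.length_eq_zero_iff.mp hw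
    refine ⟨[], rfl, _, ?_, rfl⟩
    have h := (convex_convexHull ℝ (Set.range p)) hy
      (subset_convexHull ℝ _ (Set.mem_range_self i))
      (a := 2⁻¹) (b := 2⁻¹) (by norm_num) (by norm_num) (by norm_num)
    simpa [contraction, wordMap, smul_add] using h
  | succ m =>
    obtain ⟨w, hw, y, hy, rfl⟩ := hz m
    exact ⟨i :: w, by simp [hw], y, hy, rfl⟩

theorem wordMap_mem_gasket {N : ℕ} (p : Fin (N + 1) → EuclideanSpace ℝ (Fin N))
    (w : List (Fin (N + 1))) {z : EuclideanSpace ℝ (Fin N)} (hz : z ∈ gasket p) :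
    wordMap p w z ∈ gasket p := by
  induction w with
  | nil => exact hz
  | cons i w ih => exact contraction_mem_gasket p i ih

/-- `ψ_w` as a self-map of `K`. -/
def cellMap {N : ℕ} (p : Fin (N + 1) → EuclideanSpace ℝ (Fin N)) (w : List (Fin (N + 1)))
    (x : gasket p) : gasket p :=
  ⟨wordMap p w x, wordMap_mem_gasket p w x.2⟩

/-- The vertex `p_i` as a point of `K`. -/
def vertex {N : ℕ} (p : Fin (N + 1) → EuclideanSpace ℝ (Fin N)) (i : Fin (N + 1)) : gasket p :=
  ⟨p i, vertex_mem_gasket p i⟩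

/-- The cell `K_w = ψ_w(K)`. -/
def cell {N : ℕ} (p : Fin (N + 1) → EuclideanSpace ℝ (Fin N)) (w : List (Fin (N + 1))) :
    Set (gasket p) :=
  Set.range (cellMap p w)

/-- `V_* = ⋃_m V_m`, the set of all points `ψ_w(p_i)`. -/
def vertexSet {N : ℕ} (p : Fin (N + 1) → EuclideanSpace ℝ (Fin N)) : Set (gasket p) :=
  {x | ∃ (w : List (Fin (N + 1))) (i : Fin (N + 1)), x = cellMap p w (vertex p i)}

/-- `Q_0(u, v) = (1/2) ∑_{i,j} (u_i - u_j)(v_i - v_j)` on `l(V_0) = ℝ^S`. -/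
def baseForm {N : ℕ} (u v : Fin (N + 1) → ℝ) : ℝ :=
  2⁻¹ * ∑ i, ∑ j, (u i - u j) * (v i - v j)

/-- `Q_m(f, g) = ∑_{w ∈ W_m} Q_0(f ∘ ψ_w|_{V_0}, g ∘ ψ_w|_{V_0})`. -/
def levelForm {N : ℕ} (p : Fin (N + 1) → EuclideanSpace ℝ (Fin N)) (m : ℕ)
    (f g : gasket p → ℝ) : ℝ :=
  ∑ w : Fin m → Fin (N + 1),
    baseForm (fun i => f (cellMap p (List.ofFn w) (vertex p i)))
      (fun i => g (cellMap p (List.ofFn w) (vertex p i)))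

/-- `𝓔_*(f, f) ∈ [0, ∞]`: the limit of the nondecreasing sequence
`((N + 3) / (N + 1)) ^ m * Q_m(f, f)`, that is, its supremum. -/
def energyStar {N : ℕ} (p : Fin (N + 1) → EuclideanSpace ℝ (Fin N)) (f : gasket p → ℝ) : ℝ≥0∞ :=
  ⨆ m : ℕ, ENNReal.ofReal ((((N : ℝ) + 3) / ((N : ℝ) + 1)) ^ m * levelForm p m f f)

/-- The domain `𝓕` of the Dirichlet form: continuous functions on `K` of finite energy. -/
def formDomain {N : ℕ} (p : Fin (N + 1) → EuclideanSpace ℝ (Fin N)) : Set C(gasket p, ℝ) :=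
  {f | energyStar p f < ∞}

/-- The Dirichlet form `𝓔(f, g)`, by polarization; it is used for `f, g ∈ 𝓕` only. -/
def energy {N : ℕ} (p : Fin (N + 1) → EuclideanSpace ℝ (Fin N)) (f g : C(gasket p, ℝ)) : ℝ :=
  2⁻¹ * ((energyStar p (f + g)).toReal - (energyStar p f).toReal - (energyStar p g).toReal)

/-- `ν` is an energy measure of `f`: a finite Borel measure on `K` with
`∫ g dν = 2 𝓔(f, f g) - 𝓔(f², g)` for every `g ∈ 𝓕`. -/
def IsEnergyMeasure {N : ℕ} (p : Fin (N + 1) → EuclideanSpace ℝ (Fin N)) (f : C(gasket p, ℝ))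
    (ν : Measure (gasket p)) : Prop :=
  IsFiniteMeasure ν ∧
    ∀ g ∈ formDomain p, ∫ x, g x ∂ν = 2 * energy p f (f * g) - energy p (f ^ 2) g

/-- The energy measure `ν_f` of `f ∈ 𝓕`: the measure with the property `IsEnergyMeasure`. -/
def energyMeasure {N : ℕ} (p : Fin (N + 1) → EuclideanSpace ℝ (Fin N)) (f : C(gasket p, ℝ)) :
    Measure (gasket p) :=
  Classical.epsilon (IsEnergyMeasure p f)

/-- `h` minimizes the energy among the functions in `𝓕` with boundary values `u` on `V_0`. -/
def IsHarmonicExtension {N : ℕ} (p : Fin (N + 1) → EuclideanSpace ℝ (Fin N))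
    (u : Fin (N + 1) → ℝ) (h : C(gasket p, ℝ)) : Prop :=
  h ∈ formDomain p ∧ (∀ i, h (vertex p i) = u i) ∧
    ∀ f ∈ formDomain p, (∀ i, f (vertex p i) = u i) → energy p h h ≤ energy p f f

/-- `h ∈ 𝓗`. -/
def IsHarmonic {N : ℕ} (p : Fin (N + 1) → EuclideanSpace ℝ (Fin N)) (h : C(gasket p, ℝ)) : Prop :=
  ∃ u : Fin (N + 1) → ℝ, IsHarmonicExtension p u h

/-- `ι(u)`: the harmonic function with boundary values `u`. -/
def harmonicExtension {N : ℕ} (p : Fin (N + 1) → EuclideanSpace ℝ (Fin N))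
    (u : Fin (N + 1) → ℝ) : C(gasket p, ℝ) :=
  Classical.epsilon (IsHarmonicExtension p u)

/-- The Kusuoka measure `ν = ∑_k ν_{h_k}`, where `h_k = ι(e_k)`. -/
def kusuokaMeasure {N : ℕ} (p : Fin (N + 1) → EuclideanSpace ℝ (Fin N)) : Measure (gasket p) :=
  ∑ k, energyMeasure p (harmonicExtension p (Pi.single k 1))

/-- `δ` is the pointwise density `δν_h/δν` on `V_*`: whenever `x = ψ_{wi}(p_j)`, the ratios
`ν_h(K_{w i j^n}) / ν(K_{w i j^n})` tend to `δ(x)`. -/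
def IsPointwiseDensity {N : ℕ} (p : Fin (N + 1) → EuclideanSpace ℝ (Fin N)) (h : C(gasket p, ℝ))
    (δ : vertexSet p → ℝ) : Prop :=
  ∀ (x : vertexSet p) (w : List (Fin (N + 1))) (i j : Fin (N + 1)),
    (x : gasket p) = cellMap p (w ++ [i]) (vertex p j) →
      Tendsto (fun n : ℕ =>
          (energyMeasure p h).real (cell p (w ++ [i] ++ List.replicate n j)) /
            (kusuokaMeasure p).real (cell p (w ++ [i] ++ List.replicate n j)))
        atTop (𝓝 (δ x))

/-- The set `ψ_w(p_i p_j) ∩ V_*` (line segment from `p_i` to `p_j`), as a subset of `V_*`. -/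
def edge {N : ℕ} (p : Fin (N + 1) → EuclideanSpace ℝ (Fin N)) (w : List (Fin (N + 1)))
    (i j : Fin (N + 1)) : Set (vertexSet p) :=
  {x | ((x : gasket p) : EuclideanSpace ℝ (Fin N)) ∈ wordMap p w '' segment ℝ (p i) (p j)}

end

end Gasket

open Filter Topology MeasureTheory
open scoped ENNReal NNReal

namespace Gasket

noncomputable section

/-! Everything reduces to products of the matrices `step i`, which send the boundary values of a
harmonic function to its values at the vertices of `K_i`. Write `r = (N+1)/(N+3)`, let `Q` be the
form `baseForm`, and let the flux at `j` be the normal derivative there. For a harmonic function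
with boundary values `u`, the cell `K_w` has energy mass `2 r^(-|w|) Q(restrict w u)`
(`IsEnergyMeasure.real_cell`). The inequality `≥` comes from testing against functions close to
indicators of unions of cells. The inequality `≤` follows by complement, because the small cells
that touch `K_w` from outside carry negligible mass.

At a vertex: under `step j` the flux at `j` is multiplied by `r`, so its square by `r²`, while `Q -
flux²/N` is multiplied by `r²/(N+1)²`. Along `w j^n` only the flux survives in the quotient of
masses, and the limit is the squared flux of `h` divided by the sum of the squared fluxes of the
`h_k` (`tendsto_cellMass_div`). Two addresses of one point have proportional fluxes, since at a
junction of two cells the fluxes are opposite (`exists_flux_proportional`). So the limit depends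
only on the point.

On an edge: let `A` be the flux at `i` and `B` minus the flux at `j`, as functionals of the harmonic
function. Up to the factor `r`, halving the edge replaces `(A, B)` by `(A, (A+B)/(N+1))` or by
`((A+B)/(N+1), B)`. Hence the flux at any dyadic point is a nonzero multiple of `(1-t) A + t B` with
`t ∈ [0,1]`, and the density is a fixed Lipschitz function of `t` (`edgeDensity`).

It remains to see that `t` is Hölder in the dyadic parameter. Assign weights to `A` and `B` by a
linear normalization, and let `ρ` be their ratio. The midpoint cuts the `t`-interval into pieces of
length `1/(1+ρ)` and `ρ/(1+ρ)`, and the halves have ratios `(N+1)ρ/(1+ρ)` and `(1+ρ)/(N+1)`. The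
interval `[1/N, N]` is invariant and contains the initial ratio `1`, so every halving contracts `t`
by a factor at most `N/(N+1) = 2^(-α)` with `α = log₂(1+1/N)` (`halving_rates`,
`abs_fluxPosition_sub_le`). -/

/-! ### Linear algebra of one subdivision. -/

/-- The restriction of the harmonic function with boundary values `u` to the vertices of `K_i`. -/
def step {N : ℕ} (i : Fin (N + 1)) (u : Fin (N + 1) → ℝ) : Fin (N + 1) → ℝ :=
  fun k => if k = i then u i else (u i + u k + ∑ l, u l) / ((N : ℝ) + 3)

/-- The restriction of the harmonic function with boundary values `u` to the vertices of `K_w`. -/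
def restrict {N : ℕ} : List (Fin (N + 1)) → (Fin (N + 1) → ℝ) → (Fin (N + 1) → ℝ)
  | [], u => u
  | i :: w, u => restrict w (step i u)

/-- The (inward) normal derivative at the vertex `j`. -/
def flux {N : ℕ} (j : Fin (N + 1)) (u : Fin (N + 1) → ℝ) : ℝ :=
  ∑ l, u l - ((N : ℝ) + 1) * u j

/-- The factor `(N + 1) / (N + 3)` by which normal derivatives scale. -/
def ratio (N : ℕ) : ℝ := ((N : ℝ) + 1) / ((N : ℝ) + 3)

theorem ratio_pos (N : ℕ) : 0 < ratio N := by unfold ratio; positivity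

theorem ratio_lt_one (N : ℕ) : ratio N < 1 := by
  unfold ratio
  rw [div_lt_one (by positivity)]
  linarith

theorem inv_ratio (N : ℕ) : (ratio N)⁻¹ = ((N : ℝ) + 3) / ((N : ℝ) + 1) := by
  rw [ratio, inv_div]

theorem step_self {N : ℕ} (i : Fin (N + 1)) (u : Fin (N + 1) → ℝ) : step i u i = u i := by
  simp [step]

theorem step_of_ne {N : ℕ} {i k : Fin (N + 1)} (hk : k ≠ i) (u : Fin (N + 1) → ℝ) :
    step i u k = (u i + u k + ∑ l, u l) / ((N : ℝ) + 3) := by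
  simp [step, hk]

theorem step_symm {N : ℕ} (i k : Fin (N + 1)) (u : Fin (N + 1) → ℝ) :
    step i u k = step k u i := by
  by_cases h : k = i
  · rw [h]
  · rw [step_of_ne h, step_of_ne (Ne.symm h), add_comm (u i)]

theorem baseForm_eq_sub {N : ℕ} (u v : Fin (N + 1) → ℝ) :
    baseForm u v = ((N : ℝ) + 1) * ∑ i, u i * v i - (∑ i, u i) * ∑ i, v i := by
  have h1 : ∀ i j, (u i - u j) * (v i - v j) =
      u i * v i + u j * v j - u i * v j - u j * v i := fun i j => by ring
  simp only [baseForm, h1, Finset.sum_sub_distrib, Finset.sum_add_distrib, Finset.sum_const,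
    ← Finset.mul_sum, ← Finset.sum_mul, Finset.card_univ, Fintype.card_fin, nsmul_eq_mul]
  push_cast
  ring

/-- Discrete Gauss–Green formula. -/
theorem baseForm_eq_flux {N : ℕ} (u v : Fin (N + 1) → ℝ) :
    baseForm u v = -∑ k, flux k u * v k := by
  simp only [baseForm_eq_sub, flux, sub_mul, Finset.sum_sub_distrib, ← Finset.mul_sum, mul_assoc]
  ring

theorem baseForm_self_nonneg {N : ℕ} (u : Fin (N + 1) → ℝ) : 0 ≤ baseForm u u := by
  unfold baseForm
  exact mul_nonneg (by norm_num) (Finset.sum_nonneg fun i _ => Finset.sum_nonneg fun j _ =>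
    mul_self_nonneg _)

theorem eq_of_baseForm_eq_zero {N : ℕ} {u : Fin (N + 1) → ℝ} (h : baseForm u u = 0)
    (i j : Fin (N + 1)) : u i = u j := by
  unfold baseForm at h
  have h1 : ∑ i, ∑ j, (u i - u j) * (u i - u j) = 0 := by linarith
  rw [Finset.sum_eq_zero_iff_of_nonneg (fun i _ => Finset.sum_nonneg fun j _ =>
    mul_self_nonneg _)] at h1
  have h2 := h1 i (Finset.mem_univ _)
  rw [Finset.sum_eq_zero_iff_of_nonneg (fun j _ => mul_self_nonneg _)] at h2
  have h3 := mul_self_eq_zero.mp (h2 j (Finset.mem_univ _))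
  linarith

theorem sum_step {N : ℕ} (i : Fin (N + 1)) (u : Fin (N + 1) → ℝ) :
    ∑ k, step i u k = u i + (((N : ℝ) - 1) * u i + ((N : ℝ) + 1) * ∑ l, u l) / ((N : ℝ) + 3) := by
  have h1 : ∀ k ∈ Finset.univ.erase i, step i u k = (u i + u k + ∑ l, u l) / ((N : ℝ) + 3) :=
    fun k hk => step_of_ne (Finset.ne_of_mem_erase hk) u
  rw [← Finset.add_sum_erase _ _ (Finset.mem_univ i), Finset.sum_congr rfl h1, step_self,
    ← Finset.sum_div, Finset.sum_add_distrib, Finset.sum_add_distrib,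
    Finset.sum_erase_eq_sub (Finset.mem_univ i)]
  simp [Finset.card_erase_of_mem]
  ring

theorem flux_step_self {N : ℕ} (i : Fin (N + 1)) (u : Fin (N + 1) → ℝ) :
    flux i (step i u) = ratio N * flux i u := by
  rw [flux, flux, sum_step, step_self, ratio]
  field_simp
  ring

/-- The right side is antisymmetric in `i` and `j`: the fluxes into `K_i` and `K_j` cancel at their
common point, which is harmonicity there. -/
theorem flux_step_of_ne {N : ℕ} {i j : Fin (N + 1)} (hj : j ≠ i) (u : Fin (N + 1) → ℝ) :
    flux j (step i u) = ratio N * (u i - u j) := by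
  rw [flux, sum_step, step_of_ne hj, ratio]
  field_simp
  ring

/-- A symmetric `v` is a function on `V_1`. After Gauss–Green in each cell the opposite fluxes at
junctions cancel, and only boundary terms remain. Thus harmonic extensions are orthogonal to
functions vanishing on `V_0`. -/
theorem sum_baseForm_step {N : ℕ} (u : Fin (N + 1) → ℝ) (v : Fin (N + 1) → Fin (N + 1) → ℝ)
    (hv : ∀ i k, v i k = v k i) :
    ∑ i, baseForm (step i u) (v i) = ratio N * baseForm u (fun i => v i i) := by
  have h1 : ∀ i k, flux k (step i u) * v i k =
      ratio N * (u i * v i k - u k * v k i) + (if k = i then ratio N * (flux i u * v i i) else 0) := by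
    intro i k
    by_cases h : k = i
    · subst h; simp [flux_step_self]; ring
    · rw [flux_step_of_ne h, if_neg h, hv k i]; ring
  simp only [baseForm_eq_flux, h1, Finset.sum_neg_distrib, Finset.sum_add_distrib,
    ← Finset.mul_sum, Finset.sum_sub_distrib]
  rw [Finset.sum_comm (f := fun i k => u k * v k i)]
  simp [Finset.mul_sum]

theorem sum_baseForm_step_self {N : ℕ} (u : Fin (N + 1) → ℝ) :
    ∑ i, baseForm (step i u) (step i u) = ratio N * baseForm u u := by
  rw [sum_baseForm_step u (fun i => step i u) fun i k => step_symm i k u]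
  simp [step_self]

theorem baseForm_sub_sub {N : ℕ} (u v : Fin (N + 1) → ℝ) :
    baseForm (v - u) (v - u) = baseForm v v - 2 * baseForm u v + baseForm u u := by
  simp only [baseForm, Pi.sub_apply]
  rw [mul_left_comm, ← mul_sub, ← mul_add]
  congr 1
  simp only [Finset.mul_sum, ← Finset.sum_sub_distrib, ← Finset.sum_add_distrib]
  exact Finset.sum_congr rfl fun i _ => Finset.sum_congr rfl fun j _ => by ring

/-- Pythagoras for that orthogonality. It yields both the monotonicity of the renormalized energies
and, in the case of equality, the uniqueness of minimizers. -/
theorem sum_baseForm_sub_step {N : ℕ} (v : Fin (N + 1) → Fin (N + 1) → ℝ)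
    (hv : ∀ i k, v i k = v k i) :
    ∑ i, baseForm (v i - step i fun i => v i i) (v i - step i fun i => v i i) =
      ∑ i, baseForm (v i) (v i) - ratio N * baseForm (fun i => v i i) (fun i => v i i) := by
  simp only [baseForm_sub_sub, Finset.sum_add_distrib, Finset.sum_sub_distrib, ← Finset.mul_sum]
  rw [sum_baseForm_step _ v hv, sum_baseForm_step_self]
  ring

theorem ratio_mul_baseForm_le {N : ℕ} (v : Fin (N + 1) → Fin (N + 1) → ℝ)
    (hv : ∀ i k, v i k = v k i) :
    ratio N * baseForm (fun i => v i i) (fun i => v i i) ≤ ∑ i, baseForm (v i) (v i) := by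
  have h := sum_baseForm_sub_step v hv
  have h2 : 0 ≤ ∑ i, baseForm (v i - step i fun i => v i i) (v i - step i fun i => v i i) :=
    Finset.sum_nonneg fun i _ => baseForm_self_nonneg _
  linarith

/-- Together with `flux_step_self` this makes the pair (form, squared flux) evolve by a triangular
`2 × 2` system along a repeated letter. -/
theorem baseForm_step_self {N : ℕ} (i : Fin (N + 1)) (u : Fin (N + 1) → ℝ) :
    ((N : ℝ) + 3) ^ 2 * baseForm (step i u) (step i u) =
      baseForm u u + ((N : ℝ) + 2) * flux i u ^ 2 := by
  have h1 : ∀ k ∈ Finset.univ.erase i, step i u k * step i u k =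
      (u k * u k + 2 * (u i + ∑ l, u l) * u k + (u i + ∑ l, u l) ^ 2) / ((N : ℝ) + 3) ^ 2 := by
    intro k hk
    rw [step_of_ne (Finset.ne_of_mem_erase hk)]
    field_simp
    ring
  have h2 : ∑ k, step i u k * step i u k = u i ^ 2 + (∑ k, u k * u k - u i * u i +
      2 * (u i + ∑ l, u l) * (∑ l, u l - u i) + N * (u i + ∑ l, u l) ^ 2) / ((N : ℝ) + 3) ^ 2 := by
    rw [← Finset.add_sum_erase _ _ (Finset.mem_univ i), Finset.sum_congr rfl h1, step_self,
      ← Finset.sum_div, Finset.sum_add_distrib, Finset.sum_add_distrib, ← Finset.mul_sum,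
      Finset.sum_erase_eq_sub (Finset.mem_univ i), Finset.sum_erase_eq_sub (Finset.mem_univ i)]
    simp [Finset.card_erase_of_mem]
    ring
  rw [baseForm_eq_sub, baseForm_eq_sub, h2, sum_step, flux]
  field_simp
  ring

theorem baseForm_le_baseForm_step {N : ℕ} (i : Fin (N + 1)) (u : Fin (N + 1) → ℝ) :
    baseForm u u ≤ ((N : ℝ) + 3) ^ 2 * baseForm (step i u) (step i u) := by
  rw [baseForm_step_self]
  have : 0 ≤ ((N : ℝ) + 2) * flux i u ^ 2 := by positivity
  linarith

/-- Cauchy–Schwarz for the `N` differences `u k - u i`, combined with the expression of the form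
through the same differences. -/
theorem flux_sq_le {N : ℕ} (i : Fin (N + 1)) (u : Fin (N + 1) → ℝ) :
    flux i u ^ 2 ≤ N * baseForm u u := by
  have h0 : flux i u = ∑ k ∈ Finset.univ.erase i, (u k - u i) := by
    rw [Finset.sum_erase_eq_sub (Finset.mem_univ i), Finset.sum_sub_distrib, flux]
    simp
  have h1 : flux i u ^ 2 ≤ N * ∑ k ∈ Finset.univ.erase i, (u k - u i) ^ 2 := by
    have := sq_sum_le_card_mul_sum_sq (s := Finset.univ.erase i) (f := fun k => u k - u i)
    rw [h0]
    simpa [Finset.card_erase_of_mem] using this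
  have h2 : ∑ k ∈ Finset.univ.erase i, (u k - u i) ^ 2 =
      ∑ k, u k * u k - 2 * u i * ∑ k, u k + ((N : ℝ) + 1) * u i ^ 2 := by
    rw [Finset.sum_erase_eq_sub (Finset.mem_univ i)]
    have h3 : ∀ k, (u k - u i) ^ 2 = u k * u k - 2 * u i * u k + u i ^ 2 := fun k => by ring
    simp only [h3, Finset.sum_add_distrib, Finset.sum_sub_distrib, ← Finset.mul_sum]
    simp
    ring
  have h4 : baseForm u u =
      ((N : ℝ) + 1) * ∑ k ∈ Finset.univ.erase i, (u k - u i) ^ 2 - flux i u ^ 2 := by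
    rw [h2, baseForm_eq_sub, flux]
    ring
  rw [h4]
  nlinarith

theorem baseForm_step_le {N : ℕ} (i : Fin (N + 1)) (u : Fin (N + 1) → ℝ) :
    baseForm (step i u) (step i u) ≤ ratio N ^ 2 * baseForm u u := by
  have h1 := baseForm_step_self i u
  have h2 := flux_sq_le i u
  rw [ratio, div_pow, div_mul_eq_mul_div, le_div_iff₀ (by positivity)]
  nlinarith

/-- A new value minus `u i` is a sum of `N + 1` differences of old values, each divided by `N + 3`.
-/
theorem step_diff_le {N : ℕ} (i : Fin (N + 1)) {u : Fin (N + 1) → ℝ} {M : ℝ}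
    (hu : ∀ a b, |u a - u b| ≤ M) (a b : Fin (N + 1)) :
    |step i u a - step i u b| ≤ ratio N * M := by
  have hM : 0 ≤ M := (abs_nonneg _).trans (hu a b)
  have key : ∀ k, k ≠ i → |step i u k - u i| ≤ ratio N * M := by
    intro k hk
    have h1 : step i u k - u i = ∑ l ∈ Finset.univ.erase i, (u l - u i) / ((N : ℝ) + 3) +
        (u k - u i) / ((N : ℝ) + 3) := by
      rw [step_of_ne hk, ← Finset.sum_div, Finset.sum_sub_distrib,
        Finset.sum_erase_eq_sub (Finset.mem_univ i)]
      simp [Finset.card_erase_of_mem]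
      field_simp
      ring
    have h2 : ∀ l, |(u l - u i) / ((N : ℝ) + 3)| ≤ M / ((N : ℝ) + 3) := by
      intro l
      rw [abs_div, abs_of_pos (by positivity : (0 : ℝ) < (N : ℝ) + 3)]
      gcongr
      exact hu l i
    rw [h1]
    refine (abs_add_le _ _).trans ((add_le_add ((Finset.abs_sum_le_sum_abs _ _).trans
      (Finset.sum_le_sum fun l _ => h2 l)) (h2 k)).trans (le_of_eq ?_))
    simp [Finset.card_erase_of_mem, ratio]
    ring
  by_cases ha : a = i <;> by_cases hb : b = i
  · rw [ha, hb, sub_self, abs_zero]; exact mul_nonneg (ratio_pos N).le hM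
  · rw [ha, step_self, abs_sub_comm]; exact key b hb
  · rw [hb, step_self]; exact key a ha
  · rw [step_of_ne ha, step_of_ne hb, ← sub_div, abs_div,
      abs_of_pos (by positivity : (0 : ℝ) < (N : ℝ) + 3), ratio, div_mul_eq_mul_div]
    gcongr
    have := hu a b
    have hN : (0 : ℝ) ≤ N := Nat.cast_nonneg _
    have h3 : u i + u a + ∑ l, u l - (u i + u b + ∑ l, u l) = u a - u b := by ring
    rw [h3]
    nlinarith

theorem step_mem_Icc {N : ℕ} (i : Fin (N + 1)) {u : Fin (N + 1) → ℝ} {a b : ℝ}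
    (hu : ∀ k, u k ∈ Set.Icc a b) (k : Fin (N + 1)) : step i u k ∈ Set.Icc a b := by
  by_cases hk : k = i
  · rw [hk, step_self]; exact hu i
  · have h1 : ((N : ℝ) + 1) * a ≤ ∑ l, u l := by
      have := Finset.card_nsmul_le_sum Finset.univ u a fun l _ => (hu l).1
      simpa using this
    have h2 : ∑ l, u l ≤ ((N : ℝ) + 1) * b := by
      have := Finset.sum_le_card_nsmul Finset.univ u b fun l _ => (hu l).2
      simpa using this
    rw [step_of_ne hk, Set.mem_Icc, le_div_iff₀ (by positivity), div_le_iff₀ (by positivity)]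
    constructor
    · linarith [(hu i).1, (hu k).1]
    · linarith [(hu i).2, (hu k).2]

theorem step_add {N : ℕ} (i : Fin (N + 1)) (u v : Fin (N + 1) → ℝ) :
    step i (u + v) = step i u + step i v := by
  funext k
  by_cases hk : k = i
  · simp [hk, step_self]
  · simp only [Pi.add_apply, step_of_ne hk, Finset.sum_add_distrib]; ring

theorem step_smul {N : ℕ} (i : Fin (N + 1)) (c : ℝ) (u : Fin (N + 1) → ℝ) :
    step i (c • u) = c • step i u := by
  funext k
  by_cases hk : k = i
  · simp [hk, step_self]
  · simp only [Pi.smul_apply, step_of_ne hk, smul_eq_mul, ← Finset.mul_sum]; ring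

/-- `step i` is invertible. -/
theorem step_surjective {N : ℕ} (i : Fin (N + 1)) : Function.Surjective (step i) := by
  intro v
  -- `v k = (u i + u k + s) / (N + 3)` with `u i = v i`
  set T : ℝ := ∑ k, v k with hT
  -- The sum of the unknown `u`, found by summing the equations for `v k` over `k ≠ i`.
  set s : ℝ := (((N : ℝ) + 3) * (T - v i) - ((N : ℝ) - 1) * v i) / ((N : ℝ) + 1) with hs
  set u : Fin (N + 1) → ℝ := fun k => if k = i then v i else ((N : ℝ) + 3) * v k - v i - s with hu
  have h1 : ∑ k, u k = s := by
    have h2 : ∀ k ∈ Finset.univ.erase i, u k = ((N : ℝ) + 3) * v k - v i - s :=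
      fun k hk => by simp [hu, Finset.ne_of_mem_erase hk]
    rw [← Finset.add_sum_erase _ _ (Finset.mem_univ i), Finset.sum_congr rfl h2,
      Finset.sum_sub_distrib, Finset.sum_sub_distrib, ← Finset.mul_sum,
      Finset.sum_erase_eq_sub (Finset.mem_univ i), ← hT]
    simp [Finset.card_erase_of_mem, hu]
    rw [hs]
    field_simp
    ring
  refine ⟨u, funext fun k => ?_⟩
  by_cases hk : k = i
  · rw [hk, step_self]; simp [hu]
  · rw [step_of_ne hk, h1]
    simp only [hu, if_true, if_neg hk]
    field_simp
    ring

/-! ### Iteration along words. -/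

theorem restrict_append {N : ℕ} (w w' : List (Fin (N + 1))) (u : Fin (N + 1) → ℝ) :
    restrict (w ++ w') u = restrict w' (restrict w u) := by
  induction w generalizing u with
  | nil => rfl
  | cons i w ih => exact ih _

theorem restrict_add {N : ℕ} (w : List (Fin (N + 1))) (u v : Fin (N + 1) → ℝ) :
    restrict w (u + v) = restrict w u + restrict w v := by
  induction w generalizing u v with
  | nil => rfl
  | cons i w ih => simp only [restrict, step_add, ih]

theorem restrict_smul {N : ℕ} (w : List (Fin (N + 1))) (c : ℝ) (u : Fin (N + 1) → ℝ) :
    restrict w (c • u) = c • restrict w u := by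
  induction w generalizing u with
  | nil => rfl
  | cons i w ih => simp only [restrict, step_smul, ih]

theorem restrict_surjective {N : ℕ} (w : List (Fin (N + 1))) :
    Function.Surjective (restrict w) := by
  induction w with
  | nil => exact fun v => ⟨v, rfl⟩
  | cons i w ih => exact ih.comp (step_surjective i)

theorem flux_add {N : ℕ} (j : Fin (N + 1)) (u v : Fin (N + 1) → ℝ) :
    flux j (u + v) = flux j u + flux j v := by
  simp only [flux, Pi.add_apply, Finset.sum_add_distrib]; ring

theorem flux_smul {N : ℕ} (j : Fin (N + 1)) (c : ℝ) (u : Fin (N + 1) → ℝ) :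
    flux j (c • u) = c * flux j u := by
  simp only [flux, Pi.smul_apply, smul_eq_mul, ← Finset.mul_sum]; ring

theorem flux_restrict_replicate {N : ℕ} (j : Fin (N + 1)) (n : ℕ) (u : Fin (N + 1) → ℝ) :
    flux j (restrict (List.replicate n j) u) = ratio N ^ n * flux j u := by
  induction n generalizing u with
  | zero => simp [restrict]
  | succ n ih => rw [List.replicate_succ, restrict, ih, flux_step_self]; ring

theorem baseForm_restrict_replicate_le {N : ℕ} (j : Fin (N + 1)) (n : ℕ) (u : Fin (N + 1) → ℝ) :
    baseForm (restrict (List.replicate n j) u) (restrict (List.replicate n j) u) ≤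
      (ratio N ^ 2) ^ n * baseForm u u := by
  induction n generalizing u with
  | zero => simp [restrict]
  | succ n ih =>
    rw [List.replicate_succ, restrict, pow_succ, mul_assoc]
    exact (ih _).trans (mul_le_mul_of_nonneg_left (baseForm_step_le j u)
      (pow_nonneg (sq_nonneg _) _))

/-- The triangular system diagonalized: `flux²` has eigenvalue `r²`, and `Q - flux²/N` has
eigenvalue `1/(N+3)² = r²/(N+1)²`. -/
theorem baseForm_restrict_replicate {N : ℕ} (hN : 0 < N) (j : Fin (N + 1)) (n : ℕ)
    (u : Fin (N + 1) → ℝ) :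
    baseForm (restrict (List.replicate n j) u) (restrict (List.replicate n j) u) =
      (ratio N ^ 2) ^ n * (flux j u ^ 2 / N +
        ((((N : ℝ) + 1) ^ 2)⁻¹) ^ n * (baseForm u u - flux j u ^ 2 / N)) := by
  have hN' : (0 : ℝ) < N := Nat.cast_pos.mpr hN
  induction n generalizing u with
  | zero => simp [restrict]
  | succ n ih =>
    rw [List.replicate_succ, restrict, ih, flux_step_self]
    have h1 : baseForm (step j u) (step j u) =
        (baseForm u u + ((N : ℝ) + 2) * flux j u ^ 2) / ((N : ℝ) + 3) ^ 2 := by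
      rw [← baseForm_step_self]; field_simp
    rw [h1, pow_succ (ratio N ^ 2) n, pow_succ ((((N : ℝ) + 1) ^ 2)⁻¹) n]
    generalize (ratio N ^ 2) ^ n = a
    generalize ((((N : ℝ) + 1) ^ 2)⁻¹) ^ n = b
    rw [ratio]
    field_simp
    ring

theorem baseForm_le_baseForm_restrict {N : ℕ} (w : List (Fin (N + 1))) (u : Fin (N + 1) → ℝ) :
    baseForm u u ≤ (((N : ℝ) + 3) ^ 2) ^ w.length * baseForm (restrict w u) (restrict w u) := by
  induction w generalizing u with
  | nil => simp [restrict]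
  | cons i w ih =>
    rw [restrict, List.length_cons, pow_succ']
    refine (baseForm_le_baseForm_step i u).trans ?_
    rw [mul_assoc]
    exact mul_le_mul_of_nonneg_left (ih _) (sq_nonneg _)

/-! ### Barycentric coordinates and intersections of cells. -/

/-- The vertices of the simplex as an affine basis. -/
def vertexBasis {N : ℕ} {p : Fin (N + 1) → EuclideanSpace ℝ (Fin N)}
    (hp : AffineIndependent ℝ p) : AffineBasis (Fin (N + 1)) ℝ (EuclideanSpace ℝ (Fin N)) :=
  ⟨p, hp, by
    rw [hp.affineSpan_eq_top_iff_card_eq_finrank_add_one]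
    simp⟩

theorem coord_contraction {N : ℕ} {p : Fin (N + 1) → EuclideanSpace ℝ (Fin N)}
    (hp : AffineIndependent ℝ p) (i k : Fin (N + 1)) (z : EuclideanSpace ℝ (Fin N)) :
    (vertexBasis hp).coord k (contraction p i z) =
      2⁻¹ * ((vertexBasis hp).coord k z + if k = i then 1 else 0) := by
  have h1 : contraction p i z = AffineMap.lineMap z (p i) (2⁻¹ : ℝ) := by
    rw [AffineMap.lineMap_apply_module, contraction, smul_add]
    norm_num
  have h2 : (vertexBasis hp).coord k (p i) = if k = i then 1 else 0 :=
    (vertexBasis hp).coord_apply k i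
  rw [h1, AffineMap.apply_lineMap, h2, AffineMap.lineMap_apply_module]
  simp only [smul_eq_mul]
  ring

theorem coord_nonneg {N : ℕ} {p : Fin (N + 1) → EuclideanSpace ℝ (Fin N)}
    (hp : AffineIndependent ℝ p) (k : Fin (N + 1)) {z : EuclideanSpace ℝ (Fin N)}
    (hz : z ∈ convexHull ℝ (Set.range p)) : 0 ≤ (vertexBasis hp).coord k z := by
  have h := (vertexBasis hp).convexHull_eq_nonneg_coord
  have h2 : (Set.range (vertexBasis hp)) = Set.range p := rfl
  rw [h2] at h
  rw [h] at hz
  exact hz k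

theorem coord_le_one {N : ℕ} {p : Fin (N + 1) → EuclideanSpace ℝ (Fin N)}
    (hp : AffineIndependent ℝ p) (k : Fin (N + 1)) {z : EuclideanSpace ℝ (Fin N)}
    (hz : z ∈ convexHull ℝ (Set.range p)) : (vertexBasis hp).coord k z ≤ 1 := by
  rw [← (vertexBasis hp).sum_coord_apply_eq_one z]
  exact Finset.single_le_sum (f := fun k => (vertexBasis hp).coord k z)
    (fun k _ => coord_nonneg hp k hz) (Finset.mem_univ k)

theorem coord_vertex {N : ℕ} {p : Fin (N + 1) → EuclideanSpace ℝ (Fin N)}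
    (hp : AffineIndependent ℝ p) (k i : Fin (N + 1)) :
    (vertexBasis hp).coord k (p i) = if k = i then 1 else 0 :=
  (vertexBasis hp).coord_apply k i

theorem continuous_coord {N : ℕ} {p : Fin (N + 1) → EuclideanSpace ℝ (Fin N)}
    (hp : AffineIndependent ℝ p) (k : Fin (N + 1)) : Continuous ((vertexBasis hp).coord k) :=
  AffineMap.continuous_of_finiteDimensional _

theorem eq_vertex_of_coord_eq_one {N : ℕ} {p : Fin (N + 1) → EuclideanSpace ℝ (Fin N)}
    (hp : AffineIndependent ℝ p) {k : Fin (N + 1)} {z : EuclideanSpace ℝ (Fin N)}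
    (hz : z ∈ convexHull ℝ (Set.range p)) (h : (vertexBasis hp).coord k z = 1) : z = p k := by
  refine (vertexBasis hp).ext_elem fun l => ?_
  rw [coord_vertex]
  split_ifs with hl
  · rw [hl, h]
  · have h1 := (vertexBasis hp).sum_coord_apply_eq_one z
    rw [← Finset.add_sum_erase _ _ (Finset.mem_univ k), h] at h1
    have h2 : ∑ x ∈ Finset.univ.erase k, (vertexBasis hp).coord x z = 0 := by linarith
    rw [Finset.sum_eq_zero_iff_of_nonneg fun l _ => coord_nonneg hp l hz] at h2
    exact h2 l (Finset.mem_erase.mpr ⟨hl, Finset.mem_univ _⟩)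

theorem contraction_injective {N : ℕ} (p : Fin (N + 1) → EuclideanSpace ℝ (Fin N))
    (i : Fin (N + 1)) : Function.Injective (contraction p i) := by
  intro x y h
  have h1 := smul_right_injective _ (inv_ne_zero (two_ne_zero (α := ℝ))) h
  exact add_right_cancel h1

theorem continuous_contraction {N : ℕ} (p : Fin (N + 1) → EuclideanSpace ℝ (Fin N))
    (i : Fin (N + 1)) : Continuous (contraction p i) := by
  unfold contraction
  fun_prop

theorem continuous_wordMap {N : ℕ} (p : Fin (N + 1) → EuclideanSpace ℝ (Fin N))
    (w : List (Fin (N + 1))) : Continuous (wordMap p w) := by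
  induction w with
  | nil => exact continuous_id
  | cons i w ih => exact (continuous_contraction p i).comp ih

theorem contraction_mem_hull {N : ℕ} {p : Fin (N + 1) → EuclideanSpace ℝ (Fin N)}
    (i : Fin (N + 1)) {z : EuclideanSpace ℝ (Fin N)} (hz : z ∈ convexHull ℝ (Set.range p)) :
    contraction p i z ∈ convexHull ℝ (Set.range p) := by
  have h := (convex_convexHull ℝ (Set.range p)) hz
    (subset_convexHull ℝ _ (Set.mem_range_self i))
    (a := 2⁻¹) (b := 2⁻¹) (by norm_num) (by norm_num) (by norm_num)
  simpa [contraction, smul_add] using h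

theorem gasket_subset_hull {N : ℕ} {p : Fin (N + 1) → EuclideanSpace ℝ (Fin N)} :
    gasket p ⊆ convexHull ℝ (Set.range p) := by
  intro x hx
  simp only [gasket, Set.mem_iInter, Set.mem_iUnion] at hx
  obtain ⟨w, hw, y, hy, rfl⟩ := hx 0
  obtain rfl := List.length_eq_zero_iff.mp hw
  exact hy

/-- Compare the `j`-th barycentric coordinates: that of `x` equals one plus that of `y`, so it is at
least `1`. -/
theorem contraction_eq_contraction {N : ℕ} {p : Fin (N + 1) → EuclideanSpace ℝ (Fin N)}
    (hp : AffineIndependent ℝ p) {i j : Fin (N + 1)} (hij : i ≠ j)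
    {x y : EuclideanSpace ℝ (Fin N)} (hx : x ∈ convexHull ℝ (Set.range p))
    (hy : y ∈ convexHull ℝ (Set.range p)) (h : contraction p i x = contraction p j y) :
    x = p j := by
  apply eq_vertex_of_coord_eq_one hp hx
  have h1 := congrArg ((vertexBasis hp).coord j) h
  rw [coord_contraction, coord_contraction, if_neg hij.symm, if_pos rfl] at h1
  have h2 := coord_nonneg hp j hy
  have h3 := coord_le_one hp j hx
  linarith

theorem contraction_eq_vertex {N : ℕ} {p : Fin (N + 1) → EuclideanSpace ℝ (Fin N)}
    (hp : AffineIndependent ℝ p) {i k : Fin (N + 1)} {x : EuclideanSpace ℝ (Fin N)}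
    (hx : x ∈ convexHull ℝ (Set.range p)) (h : contraction p i x = p k) : i = k ∧ x = p k := by
  have h1 := congrArg ((vertexBasis hp).coord k) h
  rw [coord_contraction, coord_vertex, if_pos rfl] at h1
  have h3 := coord_le_one hp k hx
  split_ifs at h1 with hk
  · subst hk
    refine ⟨rfl, contraction_injective p k ?_⟩
    rw [h, contraction_vertex]
  · linarith

/-- The level-`m` descriptions of `x` may start with different letters. Cells are nested, so a
letter that works at one level works at all lower ones, and by finiteness some letter works at every
level. Injectivity makes the preimage independent of the level. -/
theorem exists_contraction_eq {N : ℕ} {p : Fin (N + 1) → EuclideanSpace ℝ (Fin N)}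
    {x : EuclideanSpace ℝ (Fin N)} (hx : x ∈ gasket p) :
    ∃ i, ∃ y ∈ gasket p, contraction p i y = x := by
  have nested : ∀ (w : List (Fin (N + 1))), w ≠ [] → ∃ v : List (Fin (N + 1)),
      v.length + 1 = w.length ∧ wordMap p w '' convexHull ℝ (Set.range p) ⊆
        wordMap p v '' convexHull ℝ (Set.range p) := by
    intro w hw
    induction w with
    | nil => exact absurd rfl hw
    | cons i w ih =>
      rcases eq_or_ne w [] with rfl | hw'
      · refine ⟨[], rfl, ?_⟩
        rintro _ ⟨z, hz, rfl⟩
        exact ⟨_, contraction_mem_hull i hz, rfl⟩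
      · obtain ⟨v, hv, hsub⟩ := ih hw'
        refine ⟨i :: v, by simpa using hv, ?_⟩
        rintro _ ⟨z, hz, rfl⟩
        obtain ⟨y, hy, hyz⟩ := hsub ⟨z, hz, rfl⟩
        exact ⟨y, hy, congrArg (contraction p i) hyz⟩
  simp only [gasket, Set.mem_iInter, Set.mem_iUnion] at hx
  let P : Fin (N + 1) → ℕ → Prop := fun i m => ∃ w : List (Fin (N + 1)), w.length = m ∧
    ∃ z ∈ convexHull ℝ (Set.range p), contraction p i (wordMap p w z) = x
  have hP1 : ∀ i m, P i (m + 1) → P i m := by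
    rintro i m ⟨w, hw, z, hz, rfl⟩
    obtain ⟨v, hv, hsub⟩ := nested w (by rintro rfl; simp at hw)
    obtain ⟨y, hy, hyz⟩ := hsub ⟨z, hz, rfl⟩
    exact ⟨v, by omega, y, hy, by rw [hyz]⟩
  have hP2 : ∀ i, ∀ m n, m ≤ n → P i n → P i m := by
    intro i m n hmn
    induction n, hmn using Nat.le_induction with
    | base => exact id
    | succ n _ ih => exact fun h => ih (hP1 i n h)
  have hP3 : ∀ m, ∃ i, P i m := by
    intro m
    obtain ⟨w, hw, z, hz, rfl⟩ := hx (m + 1)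
    cases w with
    | nil => simp at hw
    | cons i w => exact ⟨i, w, by simpa using hw, z, hz, rfl⟩
  obtain ⟨i, hi⟩ : ∃ i, ∀ m, P i m := by
    by_contra! hcon
    choose f hf using hcon
    -- The sum is a level above every level `f j` at which the letter `j` fails.
    obtain ⟨i, hi⟩ := hP3 (∑ j, f j)
    exact hf i (hP2 i _ _ (Finset.single_le_sum (fun _ _ => Nat.zero_le _) (Finset.mem_univ i)) hi)
  obtain ⟨w0, hw0, y, hy, hyx⟩ := hi 0
  obtain rfl := List.length_eq_zero_iff.mp hw0
  refine ⟨i, y, ?_, hyx⟩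
  simp only [gasket, Set.mem_iInter, Set.mem_iUnion]
  intro m
  obtain ⟨w, hw, z, hz, hzx⟩ := hi m
  exact ⟨w, hw, z, hz, contraction_injective p i (hzx.trans hyx.symm)⟩

theorem isCompact_gasket {N : ℕ} (p : Fin (N + 1) → EuclideanSpace ℝ (Fin N)) :
    IsCompact (gasket p) := by
  refine ((Set.finite_range p).isCompact_convexHull (𝕜 := ℝ)).of_isClosed_subset ?_ gasket_subset_hull
  refine isClosed_iInter fun m => IsCompact.isClosed ?_
  exact (List.finite_length_eq (Fin (N + 1)) m).isCompact_biUnion fun w _ =>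
    ((Set.finite_range p).isCompact_convexHull (𝕜 := ℝ)).image (continuous_wordMap p w)

instance {N : ℕ} (p : Fin (N + 1) → EuclideanSpace ℝ (Fin N)) : CompactSpace (gasket p) :=
  isCompact_iff_compactSpace.mp (isCompact_gasket p)

theorem cellMap_cons {N : ℕ} (p : Fin (N + 1) → EuclideanSpace ℝ (Fin N)) (i : Fin (N + 1))
    (w : List (Fin (N + 1))) (x : gasket p) :
    cellMap p (i :: w) x = cellMap p [i] (cellMap p w x) := rfl

theorem cellMap_append {N : ℕ} (p : Fin (N + 1) → EuclideanSpace ℝ (Fin N))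
    (w w' : List (Fin (N + 1))) (x : gasket p) :
    cellMap p (w ++ w') x = cellMap p w (cellMap p w' x) := by
  induction w with
  | nil => rfl
  | cons i w ih => rw [List.cons_append, cellMap_cons, ih, ← cellMap_cons]

theorem cellMap_injective {N : ℕ} (p : Fin (N + 1) → EuclideanSpace ℝ (Fin N))
    (w : List (Fin (N + 1))) : Function.Injective (cellMap p w) := by
  induction w with
  | nil => exact fun x y h => h
  | cons i w ih =>
    intro x y h
    exact ih (Subtype.ext (contraction_injective p i (congrArg Subtype.val h)))

theorem continuous_cellMap {N : ℕ} (p : Fin (N + 1) → EuclideanSpace ℝ (Fin N))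
    (w : List (Fin (N + 1))) : Continuous (cellMap p w) :=
  ((continuous_wordMap p w).comp continuous_subtype_val).subtype_mk _

theorem isClosed_cell {N : ℕ} (p : Fin (N + 1) → EuclideanSpace ℝ (Fin N))
    (w : List (Fin (N + 1))) : IsClosed (cell p w) :=
  (isCompact_range (continuous_cellMap p w)).isClosed

theorem cellMap_self_vertex {N : ℕ} (p : Fin (N + 1) → EuclideanSpace ℝ (Fin N))
    (i : Fin (N + 1)) : cellMap p [i] (vertex p i) = vertex p i :=
  Subtype.ext (contraction_vertex p i)

theorem cellMap_vertex_comm {N : ℕ} (p : Fin (N + 1) → EuclideanSpace ℝ (Fin N))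
    (i j : Fin (N + 1)) : cellMap p [i] (vertex p j) = cellMap p [j] (vertex p i) :=
  Subtype.ext (congrArg ((2⁻¹ : ℝ) • ·) (add_comm (p j) (p i)))

theorem cellMap_singleton_eq {N : ℕ} {p : Fin (N + 1) → EuclideanSpace ℝ (Fin N)}
    (hp : AffineIndependent ℝ p) {i j : Fin (N + 1)} (hij : i ≠ j) {x y : gasket p}
    (h : cellMap p [i] x = cellMap p [j] y) : x = vertex p j ∧ y = vertex p i :=
  ⟨Subtype.ext (contraction_eq_contraction hp hij (gasket_subset_hull x.2)
      (gasket_subset_hull y.2) (congrArg Subtype.val h)),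
    Subtype.ext (contraction_eq_contraction hp hij.symm (gasket_subset_hull y.2)
      (gasket_subset_hull x.2) (congrArg Subtype.val h.symm))⟩

theorem cellMap_singleton_eq_vertex {N : ℕ} {p : Fin (N + 1) → EuclideanSpace ℝ (Fin N)}
    (hp : AffineIndependent ℝ p) {i k : Fin (N + 1)} {x : gasket p}
    (h : cellMap p [i] x = vertex p k) : i = k ∧ x = vertex p k := by
  obtain ⟨h1, h2⟩ := contraction_eq_vertex hp (gasket_subset_hull x.2) (congrArg Subtype.val h)
  exact ⟨h1, Subtype.ext h2⟩

theorem cellMap_eq_vertex {N : ℕ} {p : Fin (N + 1) → EuclideanSpace ℝ (Fin N)}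
    (hp : AffineIndependent ℝ p) {w : List (Fin (N + 1))} {k : Fin (N + 1)} {x : gasket p}
    (h : cellMap p w x = vertex p k) : w = List.replicate w.length k ∧ x = vertex p k := by
  induction w with
  | nil => exact ⟨rfl, h⟩
  | cons i w ih =>
    rw [cellMap_cons] at h
    obtain ⟨rfl, h2⟩ := cellMap_singleton_eq_vertex hp h
    obtain ⟨h3, h4⟩ := ih h2
    refine ⟨?_, h4⟩
    rw [List.length_cons, List.replicate_succ, ← h3]

theorem vertex_injective {N : ℕ} {p : Fin (N + 1) → EuclideanSpace ℝ (Fin N)}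
    (hp : AffineIndependent ℝ p) : Function.Injective (vertex p) :=
  fun _ _ h => hp.injective (congrArg Subtype.val h)

theorem exists_cellMap_singleton {N : ℕ} {p : Fin (N + 1) → EuclideanSpace ℝ (Fin N)}
    (x : gasket p) : ∃ (i : Fin (N + 1)) (y : gasket p), cellMap p [i] y = x := by
  obtain ⟨i, y, hy, h⟩ := exists_contraction_eq x.2
  exact ⟨i, ⟨y, hy⟩, Subtype.ext h⟩

/-- Strip the common prefix. At the first differing letter the point is a junction, so the rest of
the address leads to a vertex, which forces `x` to be a vertex. -/
theorem eq_vertex_of_cellMap_eq {N : ℕ} {p : Fin (N + 1) → EuclideanSpace ℝ (Fin N)}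
    (hp : AffineIndependent ℝ p) {v w : List (Fin (N + 1))} (hl : v.length = w.length)
    (hne : v ≠ w) {x y : gasket p} (h : cellMap p v x = cellMap p w y) :
    ∃ j, x = vertex p j := by
  induction v generalizing w with
  | nil => exact absurd (List.length_eq_zero_iff.mp hl.symm).symm hne
  | cons i v ih =>
    cases w with
    | nil => simp at hl
    | cons i' w =>
      rw [cellMap_cons, cellMap_cons p i'] at h
      by_cases hi : i = i'
      · subst hi
        exact ih (by simpa using hl) (fun hvw => hne (by rw [hvw])) (cellMap_injective p _ h)
      · exact ⟨i', (cellMap_eq_vertex hp (cellMap_singleton_eq hp hi h).1).2⟩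

/-! ### Sums over words and renormalized energies. -/

/-- The sum of `F` over all words of length `n`. -/
def wordSum {N : ℕ} (n : ℕ) (F : List (Fin (N + 1)) → ℝ) : ℝ :=
  ∑ w : Fin n → Fin (N + 1), F (List.ofFn w)

theorem wordSum_zero {N : ℕ} (F : List (Fin (N + 1)) → ℝ) : wordSum 0 F = F [] := by
  simp [wordSum]

theorem wordSum_succ {N : ℕ} (n : ℕ) (F : List (Fin (N + 1)) → ℝ) :
    wordSum (n + 1) F = ∑ i, wordSum n fun w => F (i :: w) := by
  unfold wordSum
  rw [← (Fin.consEquiv fun _ => Fin (N + 1)).sum_comp, Fintype.sum_prod_type]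
  refine Finset.sum_congr rfl fun i _ => Finset.sum_congr rfl fun w _ => ?_
  simp [Fin.consEquiv, List.ofFn_succ]

theorem wordSum_add_length {N : ℕ} (n k : ℕ) (F : List (Fin (N + 1)) → ℝ) :
    wordSum (n + k) F = wordSum n fun w => wordSum k fun w' => F (w ++ w') := by
  induction n generalizing F with
  | zero => simp [wordSum_zero]
  | succ n ih =>
    rw [Nat.succ_add_eq_add_succ, wordSum_succ, show n + (k + 1) = (n + k) + 1 from rfl,
      wordSum_succ]
    simp only [ih, List.cons_append]

theorem wordSum_congr {N : ℕ} {n : ℕ} {F G : List (Fin (N + 1)) → ℝ}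
    (h : ∀ w, w.length = n → F w = G w) : wordSum n F = wordSum n G :=
  Finset.sum_congr rfl fun _ _ => h _ (by simp)

theorem wordSum_le {N : ℕ} {n : ℕ} {F G : List (Fin (N + 1)) → ℝ}
    (h : ∀ w, w.length = n → F w ≤ G w) : wordSum n F ≤ wordSum n G :=
  Finset.sum_le_sum fun _ _ => h _ (by simp)

theorem wordSum_add {N : ℕ} (n : ℕ) (F G : List (Fin (N + 1)) → ℝ) :
    (wordSum n fun w => F w + G w) = wordSum n F + wordSum n G :=
  Finset.sum_add_distrib

theorem wordSum_sub {N : ℕ} (n : ℕ) (F G : List (Fin (N + 1)) → ℝ) :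
    (wordSum n fun w => F w - G w) = wordSum n F - wordSum n G :=
  Finset.sum_sub_distrib _ _

theorem wordSum_const_mul {N : ℕ} (n : ℕ) (c : ℝ) (F : List (Fin (N + 1)) → ℝ) :
    (wordSum n fun w => c * F w) = c * wordSum n F :=
  (Finset.mul_sum _ _ _).symm

theorem wordSum_nonneg {N : ℕ} {n : ℕ} {F : List (Fin (N + 1)) → ℝ} (h : ∀ w, 0 ≤ F w) :
    0 ≤ wordSum n F := Finset.sum_nonneg fun _ _ => h _

/-- The values of `f` at the vertices of the cell `K_w`. -/
def cellValues {N : ℕ} (p : Fin (N + 1) → EuclideanSpace ℝ (Fin N)) (f : gasket p → ℝ)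
    (w : List (Fin (N + 1))) : Fin (N + 1) → ℝ :=
  fun i => f (cellMap p w (vertex p i))

/-- The renormalized form `r⁻ᵐ Q_m(f, g)`. -/
def normForm {N : ℕ} (p : Fin (N + 1) → EuclideanSpace ℝ (Fin N)) (m : ℕ)
    (f g : gasket p → ℝ) : ℝ :=
  (ratio N)⁻¹ ^ m * wordSum m fun w => baseForm (cellValues p f w) (cellValues p g w)

theorem normForm_eq {N : ℕ} (p : Fin (N + 1) → EuclideanSpace ℝ (Fin N)) (m : ℕ)
    (f g : gasket p → ℝ) :
    normForm p m f g = (((N : ℝ) + 3) / ((N : ℝ) + 1)) ^ m * levelForm p m f g := by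
  rw [normForm, inv_ratio]
  rfl

theorem normForm_zero {N : ℕ} (p : Fin (N + 1) → EuclideanSpace ℝ (Fin N))
    (f g : gasket p → ℝ) :
    normForm p 0 f g = baseForm (cellValues p f []) (cellValues p g []) := by
  simp [normForm, wordSum_zero]

theorem normForm_succ {N : ℕ} (p : Fin (N + 1) → EuclideanSpace ℝ (Fin N)) (m : ℕ)
    (f g : gasket p → ℝ) :
    normForm p (m + 1) f g =
      (ratio N)⁻¹ * ∑ i, normForm p m (f ∘ cellMap p [i]) (g ∘ cellMap p [i]) := by
  simp only [normForm]
  rw [wordSum_succ, ← Finset.mul_sum, pow_succ', mul_assoc]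
  rfl

theorem normForm_self_nonneg {N : ℕ} (p : Fin (N + 1) → EuclideanSpace ℝ (Fin N)) (m : ℕ)
    (f : gasket p → ℝ) : 0 ≤ normForm p m f f :=
  mul_nonneg (pow_nonneg (inv_nonneg.mpr (ratio_pos N).le) _)
    (wordSum_nonneg fun _ => baseForm_self_nonneg _)

theorem cellValues_singleton_symm {N : ℕ} (p : Fin (N + 1) → EuclideanSpace ℝ (Fin N))
    (f : gasket p → ℝ) (i k : Fin (N + 1)) : cellValues p f [i] k = cellValues p f [k] i :=
  congrArg f (cellMap_vertex_comm p i k)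

theorem cellValues_singleton_self {N : ℕ} (p : Fin (N + 1) → EuclideanSpace ℝ (Fin N))
    (f : gasket p → ℝ) : (fun i => cellValues p f [i] i) = cellValues p f [] :=
  funext fun i => congrArg f (cellMap_self_vertex p i)

theorem normForm_le_succ {N : ℕ} (p : Fin (N + 1) → EuclideanSpace ℝ (Fin N)) (m : ℕ)
    (f : gasket p → ℝ) : normForm p m f f ≤ normForm p (m + 1) f f := by
  induction m generalizing f with
  | zero =>
    have h := ratio_mul_baseForm_le (cellValues p f [·]) (cellValues_singleton_symm p f)
    rw [cellValues_singleton_self] at h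
    rw [normForm_succ, normForm_zero, ← div_eq_inv_mul, le_div_iff₀ (ratio_pos N), mul_comm]
    simp only [normForm_zero]
    exact h
  | succ m ih =>
    rw [normForm_succ, normForm_succ p (m + 1)]
    exact mul_le_mul_of_nonneg_left (Finset.sum_le_sum fun i _ => ih _)
      (inv_nonneg.mpr (ratio_pos N).le)

theorem normForm_monotone {N : ℕ} (p : Fin (N + 1) → EuclideanSpace ℝ (Fin N))
    (f : gasket p → ℝ) : Monotone fun m => normForm p m f f :=
  monotone_nat_of_le_succ fun m => normForm_le_succ p m f

theorem energyStar_eq {N : ℕ} (p : Fin (N + 1) → EuclideanSpace ℝ (Fin N)) (f : gasket p → ℝ) :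
    energyStar p f = ⨆ m : ℕ, ENNReal.ofReal (normForm p m f f) := by
  simp only [energyStar, normForm_eq]

theorem normForm_le_energyStar {N : ℕ} {p : Fin (N + 1) → EuclideanSpace ℝ (Fin N)}
    {f : gasket p → ℝ} (hf : energyStar p f < ∞) (m : ℕ) :
    normForm p m f f ≤ (energyStar p f).toReal := by
  rw [← ENNReal.ofReal_le_iff_le_toReal hf.ne, energyStar_eq]
  exact le_iSup (fun m => ENNReal.ofReal (normForm p m f f)) m

theorem energyStar_lt_top {N : ℕ} {p : Fin (N + 1) → EuclideanSpace ℝ (Fin N)}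
    {f : gasket p → ℝ} {B : ℝ} (hB : ∀ m, normForm p m f f ≤ B) : energyStar p f < ∞ := by
  rw [energyStar_eq]
  exact (iSup_le fun m => ENNReal.ofReal_le_ofReal (hB m)).trans_lt ENNReal.ofReal_lt_top

theorem tendsto_normForm_self {N : ℕ} {p : Fin (N + 1) → EuclideanSpace ℝ (Fin N)}
    {f : gasket p → ℝ} (hf : energyStar p f < ∞) :
    Tendsto (fun m => normForm p m f f) atTop (𝓝 (energyStar p f).toReal) := by
  have h1 : Tendsto (fun m => ENNReal.ofReal (normForm p m f f)) atTop (𝓝 (energyStar p f)) := by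
    rw [energyStar_eq]
    exact tendsto_atTop_iSup fun m n hmn =>
      ENNReal.ofReal_le_ofReal (normForm_monotone p f hmn)
  refine ((ENNReal.tendsto_toReal hf.ne).comp h1).congr fun m => ?_
  exact ENNReal.toReal_ofReal (normForm_self_nonneg p m f)

theorem normForm_add_self {N : ℕ} (p : Fin (N + 1) → EuclideanSpace ℝ (Fin N)) (m : ℕ)
    (f g : gasket p → ℝ) :
    normForm p m (f + g) (f + g) =
      normForm p m f f + 2 * normForm p m f g + normForm p m g g := by
  have h1 : ∀ w, baseForm (cellValues p (f + g) w) (cellValues p (f + g) w) =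
      baseForm (cellValues p f w) (cellValues p f w) +
      2 * baseForm (cellValues p f w) (cellValues p g w) +
      baseForm (cellValues p g w) (cellValues p g w) := by
    intro w
    simp only [baseForm]
    rw [mul_left_comm, ← mul_add, ← mul_add]
    congr 1
    simp only [Finset.mul_sum, ← Finset.sum_add_distrib]
    refine Finset.sum_congr rfl fun i _ => Finset.sum_congr rfl fun j _ => ?_
    simp only [cellValues, Pi.add_apply]
    ring
  simp only [normForm, h1, wordSum_add, wordSum_const_mul]
  ring

theorem normForm_add_self_le {N : ℕ} (p : Fin (N + 1) → EuclideanSpace ℝ (Fin N)) (m : ℕ)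
    (f g : gasket p → ℝ) :
    normForm p m (f + g) (f + g) ≤ 2 * normForm p m f f + 2 * normForm p m g g := by
  rw [normForm, normForm, normForm, mul_left_comm, mul_left_comm 2, ← mul_add]
  refine mul_le_mul_of_nonneg_left ?_ (pow_nonneg (inv_nonneg.mpr (ratio_pos N).le) _)
  rw [← wordSum_const_mul, ← wordSum_const_mul, ← wordSum_add]
  refine wordSum_le fun w _ => ?_
  simp only [baseForm]
  rw [mul_left_comm, mul_left_comm 2, ← mul_add]
  refine mul_le_mul_of_nonneg_left ?_ (by norm_num)
  simp only [Finset.mul_sum, ← Finset.sum_add_distrib]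
  refine Finset.sum_le_sum fun i _ => Finset.sum_le_sum fun j _ => ?_
  simp only [cellValues, Pi.add_apply]
  nlinarith [sq_nonneg (f (cellMap p w (vertex p i)) - f (cellMap p w (vertex p j)) -
    (g (cellMap p w (vertex p i)) - g (cellMap p w (vertex p j))))]

/-- Discrete product rule; it makes `formDomain p` closed under multiplication. -/
theorem normForm_mul_self_le {N : ℕ} (p : Fin (N + 1) → EuclideanSpace ℝ (Fin N)) (m : ℕ)
    {f g : gasket p → ℝ} {A B : ℝ} (hA : ∀ x, |f x| ≤ A) (hB : ∀ x, |g x| ≤ B) :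
    normForm p m (f * g) (f * g) ≤
      2 * A ^ 2 * normForm p m g g + 2 * B ^ 2 * normForm p m f f := by
  rw [normForm, normForm, normForm, mul_left_comm, mul_left_comm (2 * B ^ 2), ← mul_add]
  refine mul_le_mul_of_nonneg_left ?_ (pow_nonneg (inv_nonneg.mpr (ratio_pos N).le) _)
  rw [← wordSum_const_mul, ← wordSum_const_mul, ← wordSum_add]
  refine wordSum_le fun w _ => ?_
  simp only [baseForm]
  rw [mul_left_comm, mul_left_comm (2 * B ^ 2), ← mul_add]
  refine mul_le_mul_of_nonneg_left ?_ (by norm_num)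
  simp only [Finset.mul_sum, ← Finset.sum_add_distrib]
  refine Finset.sum_le_sum fun i _ => Finset.sum_le_sum fun j _ => ?_
  simp only [cellValues, Pi.mul_apply]
  generalize cellMap p w (vertex p i) = x
  generalize cellMap p w (vertex p j) = y
  have h1 : f x ^ 2 ≤ A ^ 2 := sq_le_sq' (abs_le.mp (hA x)).1 (abs_le.mp (hA x)).2
  have h2 : g y ^ 2 ≤ B ^ 2 := sq_le_sq' (abs_le.mp (hB y)).1 (abs_le.mp (hB y)).2
  have h3 : f x * g x - f y * g y = f x * (g x - g y) + g y * (f x - f y) := by ring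
  rw [h3]
  nlinarith [sq_nonneg (f x * (g x - g y) - g y * (f x - f y)),
    mul_le_mul_of_nonneg_right h1 (sq_nonneg (g x - g y)),
    mul_le_mul_of_nonneg_right h2 (sq_nonneg (f x - f y))]

theorem add_mem_formDomain {N : ℕ} {p : Fin (N + 1) → EuclideanSpace ℝ (Fin N)}
    {f g : C(gasket p, ℝ)} (hf : f ∈ formDomain p) (hg : g ∈ formDomain p) :
    f + g ∈ formDomain p :=
  energyStar_lt_top (B := 2 * (energyStar p f).toReal + 2 * (energyStar p g).toReal) fun m => by
    have := normForm_le_energyStar hf m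
    have := normForm_le_energyStar hg m
    exact (normForm_add_self_le p m f g).trans (by linarith)

theorem mul_mem_formDomain {N : ℕ} {p : Fin (N + 1) → EuclideanSpace ℝ (Fin N)}
    {f g : C(gasket p, ℝ)} (hf : f ∈ formDomain p) (hg : g ∈ formDomain p) :
    f * g ∈ formDomain p :=
  energyStar_lt_top (B := 2 * ‖f‖ ^ 2 * (energyStar p g).toReal +
      2 * ‖g‖ ^ 2 * (energyStar p f).toReal) fun m => by
    refine (normForm_mul_self_le p m (f := f) (g := g) (fun x => f.norm_coe_le_norm x)
      (fun x => g.norm_coe_le_norm x)).trans ?_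
    have := normForm_le_energyStar hf m
    have := normForm_le_energyStar hg m
    gcongr

theorem const_mem_formDomain {N : ℕ} (p : Fin (N + 1) → EuclideanSpace ℝ (Fin N)) (c : ℝ) :
    ContinuousMap.const _ c ∈ formDomain p :=
  energyStar_lt_top (B := 0) fun m => by
    simp [normForm, cellValues, baseForm, wordSum]

theorem tendsto_normForm {N : ℕ} {p : Fin (N + 1) → EuclideanSpace ℝ (Fin N)}
    {f g : C(gasket p, ℝ)} (hf : f ∈ formDomain p) (hg : g ∈ formDomain p) :
    Tendsto (fun m => normForm p m f g) atTop (𝓝 (energy p f g)) := by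
  have h1 := tendsto_normForm_self (add_mem_formDomain hf hg)
  have h2 := (((h1.sub (tendsto_normForm_self hf)).sub (tendsto_normForm_self hg)).const_mul
    (2⁻¹ : ℝ))
  refine h2.congr fun m => ?_
  rw [ContinuousMap.coe_add, normForm_add_self]
  ring

theorem energy_self {N : ℕ} {p : Fin (N + 1) → EuclideanSpace ℝ (Fin N)}
    {f : C(gasket p, ℝ)} (hf : f ∈ formDomain p) : energy p f f = (energyStar p f).toReal :=
  tendsto_nhds_unique (tendsto_normForm hf hf) (tendsto_normForm_self hf)

/-! ### Discrete energy measures. -/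

/-- The discrete approximation `r⁻ᵐ ∑_w ∑_{i,j} (f_i - f_j)² g_i` of `∫ g dν_f`. -/
def massForm {N : ℕ} (p : Fin (N + 1) → EuclideanSpace ℝ (Fin N)) (m : ℕ)
    (f g : gasket p → ℝ) : ℝ :=
  (ratio N)⁻¹ ^ m * wordSum m fun w => ∑ i, ∑ j,
    (cellValues p f w i - cellValues p f w j) ^ 2 * cellValues p g w i

/-- Edge by edge, `2(a-b)(ac-bd) - (a²-b²)(c-d) = (a-b)²(c+d)`. This exhibits the defining
functional of `ν_f` as a limit of functionals that are positive in `g` and defined for every `g`. -/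
theorem massForm_eq {N : ℕ} (p : Fin (N + 1) → EuclideanSpace ℝ (Fin N)) (m : ℕ)
    (f g : gasket p → ℝ) :
    massForm p m f g = 2 * normForm p m f (f * g) - normForm p m (f ^ 2) g := by
  have h1 : ∀ w, ∑ i, ∑ j, (cellValues p f w i - cellValues p f w j) ^ 2 * cellValues p g w i =
      2 * baseForm (cellValues p f w) (cellValues p (f * g) w) -
        baseForm (cellValues p (f ^ 2) w) (cellValues p g w) := by
    intro w
    have h2 : ∑ i, ∑ j, (cellValues p f w i - cellValues p f w j) ^ 2 * cellValues p g w i =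
        2⁻¹ * ∑ i, ∑ j, (cellValues p f w i - cellValues p f w j) ^ 2 *
          (cellValues p g w i + cellValues p g w j) := by
      simp only [mul_add, Finset.sum_add_distrib]
      rw [Finset.sum_comm (f := fun i j =>
        (cellValues p f w i - cellValues p f w j) ^ 2 * cellValues p g w j)]
      have : ∀ i j, (cellValues p f w j - cellValues p f w i) ^ 2 =
        (cellValues p f w i - cellValues p f w j) ^ 2 := fun i j => by ring
      simp only [this]
      ring
    rw [h2, baseForm, baseForm, mul_left_comm, ← mul_sub]
    congr 1
    rw [Finset.mul_sum, ← Finset.sum_sub_distrib]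
    refine Finset.sum_congr rfl fun i _ => ?_
    rw [Finset.mul_sum, ← Finset.sum_sub_distrib]
    refine Finset.sum_congr rfl fun j _ => ?_
    simp only [cellValues, Pi.mul_apply, Pi.pow_apply]
    ring
  simp only [massForm, h1, normForm, wordSum_sub, wordSum_const_mul]
  ring

theorem massForm_add_length {N : ℕ} (p : Fin (N + 1) → EuclideanSpace ℝ (Fin N)) (n k : ℕ)
    (f g : gasket p → ℝ) :
    massForm p (n + k) f g = (ratio N)⁻¹ ^ n *
      wordSum n fun w => massForm p k (f ∘ cellMap p w) (g ∘ cellMap p w) := by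
  simp only [massForm, wordSum_add_length, wordSum_const_mul, pow_add, mul_assoc]
  congr 3
  funext w
  congr 1
  funext w'
  simp only [cellValues, Function.comp_apply, cellMap_append]

theorem massForm_mono {N : ℕ} (p : Fin (N + 1) → EuclideanSpace ℝ (Fin N)) (m : ℕ)
    (f : gasket p → ℝ) {g g' : gasket p → ℝ} (h : ∀ x, g x ≤ g' x) :
    massForm p m f g ≤ massForm p m f g' :=
  mul_le_mul_of_nonneg_left (wordSum_le fun _ _ => Finset.sum_le_sum fun _ _ =>
    Finset.sum_le_sum fun _ _ => mul_le_mul_of_nonneg_left (h _) (sq_nonneg _))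
    (pow_nonneg (inv_nonneg.mpr (ratio_pos N).le) _)

theorem massForm_const {N : ℕ} (p : Fin (N + 1) → EuclideanSpace ℝ (Fin N)) (m : ℕ)
    (f : gasket p → ℝ) (c : ℝ) : massForm p m f (fun _ => c) = 2 * c * normForm p m f f := by
  simp only [massForm, normForm, baseForm, cellValues, wordSum_const_mul, ← Finset.sum_mul, ← pow_two]
  rw [← mul_assoc, ← mul_assoc]
  simp only [mul_comm _ c, wordSum_const_mul]
  ring

theorem massForm_add {N : ℕ} (p : Fin (N + 1) → EuclideanSpace ℝ (Fin N)) (m : ℕ)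
    (f g g' : gasket p → ℝ) :
    massForm p m f (g + g') = massForm p m f g + massForm p m f g' := by
  simp only [massForm, cellValues, Pi.add_apply, mul_add, Finset.sum_add_distrib, wordSum_add]

theorem massForm_smul {N : ℕ} (p : Fin (N + 1) → EuclideanSpace ℝ (Fin N)) (m : ℕ)
    (f : gasket p → ℝ) (c : ℝ) (g : gasket p → ℝ) :
    massForm p m f (c • g) = c * massForm p m f g := by
  simp only [massForm, cellValues, Pi.smul_apply, smul_eq_mul, mul_left_comm _ c,
    ← Finset.mul_sum, wordSum_const_mul]

theorem tendsto_massForm {N : ℕ} {p : Fin (N + 1) → EuclideanSpace ℝ (Fin N)}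
    {f g : C(gasket p, ℝ)} (hf : f ∈ formDomain p) (hg : g ∈ formDomain p) :
    Tendsto (fun m => massForm p m f g) atTop
      (𝓝 (2 * energy p f (f * g) - energy p (f ^ 2) g)) := by
  have hf2 : f ^ 2 ∈ formDomain p := by rw [pow_two]; exact mul_mem_formDomain hf hf
  refine (((tendsto_normForm hf (mul_mem_formDomain hf hg)).const_mul 2).sub
    (tendsto_normForm hf2 hg)).congr fun m => ?_
  rw [massForm_eq]
  rfl

theorem abs_massForm_le {N : ℕ} {p : Fin (N + 1) → EuclideanSpace ℝ (Fin N)}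
    {f : gasket p → ℝ} (hf : energyStar p f < ∞) (g : C(gasket p, ℝ)) (m : ℕ) :
    |massForm p m f g| ≤ 2 * ‖g‖ * (energyStar p f).toReal := by
  have h1 := massForm_mono p m f (g := g) (g' := fun _ => ‖g‖)
    fun x => (le_abs_self _).trans (g.norm_coe_le_norm x)
  have h2 := massForm_mono p m f (g := fun _ => -‖g‖) (g' := g)
    fun x => (abs_le.mp (g.norm_coe_le_norm x)).1
  rw [massForm_const] at h1 h2
  have h3 := normForm_le_energyStar hf m
  have h4 := mul_le_mul_of_nonneg_left h3 (norm_nonneg g)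
  rw [abs_le]
  constructor <;> linarith

/-! ### Construction of harmonic functions. -/

/-- The first letter of an address of `x`. -/
def head {N : ℕ} {p : Fin (N + 1) → EuclideanSpace ℝ (Fin N)} (x : gasket p) : Fin (N + 1) :=
  (exists_cellMap_singleton x).choose

/-- The preimage of `x` under the contraction `head x`. -/
def tail {N : ℕ} {p : Fin (N + 1) → EuclideanSpace ℝ (Fin N)} (x : gasket p) : gasket p :=
  (exists_cellMap_singleton x).choose_spec.choose

theorem cellMap_head_tail {N : ℕ} {p : Fin (N + 1) → EuclideanSpace ℝ (Fin N)} (x : gasket p) :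
    cellMap p [head x] (tail x) = x :=
  (exists_cellMap_singleton x).choose_spec.choose_spec

/-- The function on `K` that agrees with the harmonic function with boundary values `u` on `V_n`
and is affine on the cells of level `n`. -/
def affineApprox {N : ℕ} {p : Fin (N + 1) → EuclideanSpace ℝ (Fin N)}
    (hp : AffineIndependent ℝ p) : ℕ → (Fin (N + 1) → ℝ) → gasket p → ℝ
  | 0, u, x => ∑ k, (vertexBasis hp).coord k x * u k
  | n + 1, u, x => affineApprox hp n (step (head x) u) (tail x)

theorem affineApprox_vertex {N : ℕ} {p : Fin (N + 1) → EuclideanSpace ℝ (Fin N)}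
    (hp : AffineIndependent ℝ p) (n : ℕ) (u : Fin (N + 1) → ℝ) (j : Fin (N + 1)) :
    affineApprox hp n u (vertex p j) = u j := by
  induction n generalizing u with
  | zero => simp [affineApprox, vertex, coord_vertex]
  | succ n ih =>
    obtain ⟨h1, h2⟩ := cellMap_singleton_eq_vertex hp (cellMap_head_tail (vertex p j))
    rw [affineApprox, h1, h2, ih, step_self]

/-- The chosen `head` is immaterial: if it differs from `i`, the point is a junction, and the two
prescriptions agree there by `step_symm`. -/
theorem affineApprox_succ {N : ℕ} {p : Fin (N + 1) → EuclideanSpace ℝ (Fin N)}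
    (hp : AffineIndependent ℝ p) (n : ℕ) (u : Fin (N + 1) → ℝ) (i : Fin (N + 1)) (x : gasket p) :
    affineApprox hp (n + 1) u (cellMap p [i] x) = affineApprox hp n (step i u) x := by
  rw [affineApprox]
  have h := cellMap_head_tail (cellMap p [i] x)
  by_cases hi : head (cellMap p [i] x) = i
  · rw [hi] at h ⊢
    rw [cellMap_injective p [i] h]
  · obtain ⟨h1, h2⟩ := cellMap_singleton_eq hp hi h
    generalize head (cellMap p [i] x) = k at *
    rw [h1, h2, affineApprox_vertex, affineApprox_vertex, step_symm]

theorem continuous_affineApprox {N : ℕ} {p : Fin (N + 1) → EuclideanSpace ℝ (Fin N)}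
    (hp : AffineIndependent ℝ p) (n : ℕ) (u : Fin (N + 1) → ℝ) :
    Continuous (affineApprox hp n u) := by
  induction n generalizing u with
  | zero =>
    exact continuous_finsetSum _ fun k _ =>
      ((continuous_coord hp k).comp continuous_subtype_val).mul continuous_const
  | succ n ih =>
    refine (locallyFinite_of_finite fun i : Fin (N + 1) => cell p [i]).continuous
      (Set.eq_univ_of_forall fun x => Set.mem_iUnion.mpr
        ⟨head x, tail x, cellMap_head_tail x⟩) (fun i => isClosed_cell p [i]) fun i => ?_
    have hq : IsClosedEmbedding (cellMap p [i]) :=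
      (continuous_cellMap p [i]).isClosedEmbedding (cellMap_injective p [i])
    rw [cell, ← Set.image_univ, hq.isInducing.continuousOn_image_iff, continuousOn_univ]
    exact (ih (step i u)).congr fun x => (affineApprox_succ hp n u i x).symm

theorem affineApprox_mem_Icc {N : ℕ} {p : Fin (N + 1) → EuclideanSpace ℝ (Fin N)}
    (hp : AffineIndependent ℝ p) (n : ℕ) {u : Fin (N + 1) → ℝ} {a b : ℝ}
    (hu : ∀ k, u k ∈ Set.Icc a b) (x : gasket p) : affineApprox hp n u x ∈ Set.Icc a b := by
  induction n generalizing u x with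
  | zero =>
    have h := (convex_Icc a b).sum_mem (t := Finset.univ)
      (w := fun k => (vertexBasis hp).coord k (x : EuclideanSpace ℝ (Fin N))) (z := u)
      (fun k _ => coord_nonneg hp k (gasket_subset_hull x.2))
      ((vertexBasis hp).sum_coord_apply_eq_one _) (fun k _ => hu k)
    simpa [affineApprox] using h
  | succ n ih => exact ih (step_mem_Icc _ hu) _

/-- By the maximum principle both functions stay within `M` of a vertex value, and each further
level shrinks the oscillation by `ratio N`. -/
theorem affineApprox_dist_le {N : ℕ} {p : Fin (N + 1) → EuclideanSpace ℝ (Fin N)}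
    (hp : AffineIndependent ℝ p) (n : ℕ) {u : Fin (N + 1) → ℝ} {M : ℝ}
    (hu : ∀ a b, |u a - u b| ≤ M) (x : gasket p) :
    dist (affineApprox hp n u x) (affineApprox hp (n + 1) u x) ≤ 2 * M * ratio N ^ n := by
  induction n generalizing u M x with
  | zero =>
    have h1 : ∀ k, u k ∈ Set.Icc (u 0 - M) (u 0 + M) := fun k => by
      have := abs_le.mp (hu k 0)
      constructor <;> linarith
    have h2 := affineApprox_mem_Icc hp 0 h1 x
    have h3 := affineApprox_mem_Icc hp 1 h1 x
    rw [Real.dist_eq, abs_le]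
    constructor <;> linarith [h2.1, h2.2, h3.1, h3.2]
  | succ n ih =>
    refine (ih (step_diff_le (head x) hu) (tail x)).trans (le_of_eq ?_)
    ring

/-- Existence of continuous functions on `K` that restrict to each cell by the matrices `step`. -/
theorem exists_harmonic {N : ℕ} {p : Fin (N + 1) → EuclideanSpace ℝ (Fin N)}
    (hp : AffineIndependent ℝ p) (u : Fin (N + 1) → ℝ) :
    ∃ f : C(gasket p, ℝ), ∀ x, Tendsto (fun n => affineApprox hp n u x) atTop (𝓝 (f x)) := by
  have hu : ∀ a b, |u a - u b| ≤ 2 * ‖u‖ := fun a b => by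
    have h1 := norm_le_pi_norm u a
    have h2 := norm_le_pi_norm u b
    rw [Real.norm_eq_abs] at h1 h2
    exact (abs_sub _ _).trans (by linarith)
  have hd := fun x n => affineApprox_dist_le hp n hu x
  have h1 : ∀ x, ∃ y, Tendsto (fun n => affineApprox hp n u x) atTop (𝓝 y) := fun x =>
    cauchySeq_tendsto_of_complete (cauchySeq_of_le_geometric _ _ (ratio_lt_one N) (hd x))
  choose f hf using h1
  have h2 : TendstoUniformly (fun n => affineApprox hp n u) f atTop := by
    rw [Metric.tendstoUniformly_iff]
    intro ε hε
    have h3 : Tendsto (fun n : ℕ => 2 * (2 * ‖u‖) * ratio N ^ n / (1 - ratio N)) atTop (𝓝 0) := by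
      have := ((tendsto_pow_atTop_nhds_zero_of_lt_one (ratio_pos N).le (ratio_lt_one N)).const_mul
        (2 * (2 * ‖u‖))).div_const (1 - ratio N)
      simpa using this
    filter_upwards [h3.eventually (gt_mem_nhds hε)] with n hn x
    rw [dist_comm]
    exact (dist_le_of_le_geometric_of_tendsto _ _ (ratio_lt_one N) (hd x) (hf x) n).trans_lt hn
  exact ⟨⟨f, h2.continuous (Frequently.of_forall fun n => continuous_affineApprox hp n u)⟩, hf⟩

/-- The harmonic function with boundary values `u`, constructed as a limit. -/
def harmonicLimit {N : ℕ} {p : Fin (N + 1) → EuclideanSpace ℝ (Fin N)}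
    (hp : AffineIndependent ℝ p) (u : Fin (N + 1) → ℝ) : C(gasket p, ℝ) :=
  (exists_harmonic hp u).choose

theorem tendsto_affineApprox {N : ℕ} {p : Fin (N + 1) → EuclideanSpace ℝ (Fin N)}
    (hp : AffineIndependent ℝ p) (u : Fin (N + 1) → ℝ) (x : gasket p) :
    Tendsto (fun n => affineApprox hp n u x) atTop (𝓝 (harmonicLimit hp u x)) :=
  (exists_harmonic hp u).choose_spec x

theorem harmonicLimit_cellMap {N : ℕ} {p : Fin (N + 1) → EuclideanSpace ℝ (Fin N)}
    (hp : AffineIndependent ℝ p) (u : Fin (N + 1) → ℝ) (i : Fin (N + 1)) (x : gasket p) :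
    harmonicLimit hp u (cellMap p [i] x) = harmonicLimit hp (step i u) x := by
  refine tendsto_nhds_unique ((tendsto_affineApprox hp u _).comp (tendsto_add_atTop_nat 1)) ?_
  refine (tendsto_affineApprox hp (step i u) x).congr fun n => ?_
  exact (affineApprox_succ hp n u i x).symm

theorem harmonicLimit_vertex {N : ℕ} {p : Fin (N + 1) → EuclideanSpace ℝ (Fin N)}
    (hp : AffineIndependent ℝ p) (u : Fin (N + 1) → ℝ) (j : Fin (N + 1)) :
    harmonicLimit hp u (vertex p j) = u j := by
  refine tendsto_nhds_unique (tendsto_affineApprox hp u _) ?_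
  simp only [affineApprox_vertex]
  exact tendsto_const_nhds

theorem harmonicLimit_mem_Icc {N : ℕ} {p : Fin (N + 1) → EuclideanSpace ℝ (Fin N)}
    (hp : AffineIndependent ℝ p) {u : Fin (N + 1) → ℝ} {a b : ℝ}
    (hu : ∀ k, u k ∈ Set.Icc a b) (x : gasket p) : harmonicLimit hp u x ∈ Set.Icc a b :=
  isClosed_Icc.mem_of_tendsto (tendsto_affineApprox hp u x)
    (Eventually.of_forall fun n => affineApprox_mem_Icc hp n hu x)

theorem harmonicLimit_pos {N : ℕ} {p : Fin (N + 1) → EuclideanSpace ℝ (Fin N)}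
    (hp : AffineIndependent ℝ p) {u : Fin (N + 1) → ℝ} (hu : ∀ k, 0 < u k) (x : gasket p) :
    0 < harmonicLimit hp u x := by
  obtain ⟨a, ha⟩ := Finite.exists_min u
  obtain ⟨b, hb⟩ := Finite.exists_max u
  exact (hu a).trans_le (harmonicLimit_mem_Icc hp (fun k => ⟨ha k, hb k⟩) x).1

theorem harmonicLimit_nonpos {N : ℕ} {p : Fin (N + 1) → EuclideanSpace ℝ (Fin N)}
    (hp : AffineIndependent ℝ p) {u : Fin (N + 1) → ℝ} (hu : ∀ k, u k ≤ 0) (x : gasket p) :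
    harmonicLimit hp u x ≤ 0 := by
  obtain ⟨a, ha⟩ := Finite.exists_min u
  exact (harmonicLimit_mem_Icc hp (fun k => ⟨ha k, hu k⟩) x).2

/-! ### Harmonic functions separate points. -/

/-- A strong maximum principle: off `K_j` the function is strictly positive, and on `K_j` the sign
pattern of the boundary values recurs. A zero therefore lies in `K_{j^n}` for every `n`. -/
theorem one_sub_coord_le {N : ℕ} {p : Fin (N + 1) → EuclideanSpace ℝ (Fin N)}
    (hp : AffineIndependent ℝ p) (j : Fin (N + 1)) (n : ℕ) {u : Fin (N + 1) → ℝ}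
    (hu : ∀ k, 0 ≤ u k) (hu' : ∀ k, k ≠ j → 0 < u k) {x : gasket p}
    (hx : harmonicLimit hp u x ≤ 0) : 1 - (vertexBasis hp).coord j x ≤ 2⁻¹ ^ n := by
  induction n generalizing u x with
  | zero =>
    have := coord_nonneg hp j (gasket_subset_hull x.2)
    simp [this]
  | succ n ih =>
    obtain ⟨i, y, rfl⟩ := exists_cellMap_singleton x
    rw [harmonicLimit_cellMap] at hx
    have hs : ∀ k, u k ≤ ∑ l, u l := fun k =>
      Finset.single_le_sum (fun l _ => hu l) (Finset.mem_univ k)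
    by_cases hi : i = j
    · subst hi
      have h1 := ih (u := step i u) (x := y) (fun k => ?_) (fun k hk => ?_) hx
      · have h2 : (vertexBasis hp).coord i (cellMap p [i] y) =
            2⁻¹ * ((vertexBasis hp).coord i y + if i = i then 1 else 0) :=
          coord_contraction hp i i y
        rw [h2, if_pos rfl, pow_succ]
        linarith
      · by_cases hk : k = i
        · rw [hk, step_self]; exact hu i
        · rw [step_of_ne hk]
          have := hu i; have := hu k; have := hs k
          exact div_nonneg (by linarith) (by positivity)
      · rw [step_of_ne hk]
        have := hu i; have := hu' k hk; have := hs k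
        exact div_pos (by linarith) (by positivity)
    · refine absurd hx (not_le.mpr (harmonicLimit_pos hp (fun k => ?_) y))
      by_cases hk : k = i
      · rw [hk, step_self]; exact hu' i hi
      · rw [step_of_ne hk]
        have := hu' i hi; have := hu k; have := hs k
        exact div_pos (by linarith) (by positivity)

theorem eq_vertex_of_harmonicLimit_nonpos {N : ℕ} {p : Fin (N + 1) → EuclideanSpace ℝ (Fin N)}
    (hp : AffineIndependent ℝ p) (j : Fin (N + 1)) {u : Fin (N + 1) → ℝ}
    (hu : ∀ k, 0 ≤ u k) (hu' : ∀ k, k ≠ j → 0 < u k) {x : gasket p}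
    (hx : harmonicLimit hp u x ≤ 0) : x = vertex p j := by
  have h1 : 1 - (vertexBasis hp).coord j x ≤ 0 :=
    ge_of_tendsto' (tendsto_pow_atTop_nhds_zero_of_lt_one (by norm_num) (by norm_num))
      fun n => one_sub_coord_le hp j n hu hu' hx
  have h2 := coord_le_one hp j (gasket_subset_hull x.2)
  exact Subtype.ext (eq_vertex_of_coord_eq_one hp (gasket_subset_hull x.2) (by linarith))

theorem eq_vertex_of_harmonicLimit_eq {N : ℕ} {p : Fin (N + 1) → EuclideanSpace ℝ (Fin N)}
    (hp : AffineIndependent ℝ p) {i j : Fin (N + 1)} (hij : i ≠ j) {x y : gasket p}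
    (h : ∀ u, harmonicLimit hp u (cellMap p [i] x) = harmonicLimit hp u (cellMap p [j] y)) :
    x = vertex p j := by
  -- This antisymmetric choice is nonpositive on `K_j`, and its vertex values on `K_i` are positive
  -- except for a zero at the point shared with `K_j`.
  set u : Fin (N + 1) → ℝ := Pi.single i 1 - Pi.single j 1 with hu
  have hsum : ∑ l, u l = 0 := by simp [hu]
  have hui : u i = 1 := by simp [hu, hij]
  have huj : u j = -1 := by simp [hu, hij.symm]
  have huk : ∀ k, k ≠ i → k ≠ j → u k = 0 := fun k h1 h2 => by simp [hu, h1, h2]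
  have hy : harmonicLimit hp (step j u) y ≤ 0 := by
    refine harmonicLimit_nonpos hp (fun k => ?_) y
    by_cases h1 : k = j
    · rw [h1, step_self, huj]; norm_num
    · rw [step_of_ne h1, hsum, huj]
      refine div_nonpos_of_nonpos_of_nonneg ?_ (by positivity)
      by_cases h2 : k = i
      · rw [h2, hui]; norm_num
      · rw [huk k h2 h1]; norm_num
  have hpos : ∀ k, k ≠ j → 0 < step i u k := fun k hk => by
    by_cases h1 : k = i
    · rw [h1, step_self, hui]; norm_num
    · rw [step_of_ne h1, hsum, hui, huk k h1 hk]
      exact div_pos (by norm_num) (by positivity)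
  refine eq_vertex_of_harmonicLimit_nonpos hp j (u := step i u) (fun k => ?_) hpos ?_
  · by_cases hk : k = j
    · rw [hk, step_of_ne hij.symm, hsum, hui, huj]; norm_num
    · exact (hpos k hk).le
  · rw [← harmonicLimit_cellMap, h u, harmonicLimit_cellMap]
    exact hy

/-- In a common cell, surjectivity of `step i` passes the hypothesis to the preimages and the
coordinate difference halves. In different cells both points must be the junction. -/
theorem eq_of_harmonicLimit_eq {N : ℕ} {p : Fin (N + 1) → EuclideanSpace ℝ (Fin N)}
    (hp : AffineIndependent ℝ p) {x y : gasket p}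
    (h : ∀ u, harmonicLimit hp u x = harmonicLimit hp u y) : x = y := by
  have key : ∀ (n : ℕ) (x y : gasket p), (∀ u, harmonicLimit hp u x = harmonicLimit hp u y) →
      ∀ k, |(vertexBasis hp).coord k x - (vertexBasis hp).coord k y| ≤ 2⁻¹ ^ n := by
    intro n
    induction n with
    | zero =>
      intro x y _ k
      have h1 := coord_nonneg hp k (gasket_subset_hull x.2)
      have h2 := coord_nonneg hp k (gasket_subset_hull y.2)
      have h3 := coord_le_one hp k (gasket_subset_hull x.2)
      have h4 := coord_le_one hp k (gasket_subset_hull y.2)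
      rw [pow_zero, abs_le]
      constructor <;> linarith
    | succ n ih =>
      intro x y hxy k
      obtain ⟨i, x, rfl⟩ := exists_cellMap_singleton x
      obtain ⟨j, y, rfl⟩ := exists_cellMap_singleton y
      by_cases hij : i = j
      · subst hij
        have h1 := ih x y (fun u => by
          obtain ⟨v, rfl⟩ := step_surjective i u
          simpa only [harmonicLimit_cellMap] using hxy v) k
        have h2 : ∀ z, (vertexBasis hp).coord k (cellMap p [i] z) =
            2⁻¹ * ((vertexBasis hp).coord k z + if k = i then 1 else 0) :=
          fun z => coord_contraction hp i k z
        rw [h2, h2, ← mul_sub, add_sub_add_right_eq_sub, abs_mul, pow_succ']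
        rw [abs_of_pos (by norm_num : (0 : ℝ) < 2⁻¹)]
        gcongr
      · rw [eq_vertex_of_harmonicLimit_eq hp hij hxy,
          eq_vertex_of_harmonicLimit_eq hp (Ne.symm hij) fun u => (hxy u).symm,
          cellMap_vertex_comm, sub_self, abs_zero]
        positivity
  refine Subtype.ext ((vertexBasis hp).ext_elem fun k => ?_)
  have h1 : |(vertexBasis hp).coord k x - (vertexBasis hp).coord k y| ≤ 0 :=
    ge_of_tendsto' (tendsto_pow_atTop_nhds_zero_of_lt_one (by norm_num) (by norm_num))
      fun n => key n x y h k
  exact sub_eq_zero.mp (abs_nonpos_iff.mp h1)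

/-! ### Energy minimizers are given by the matrices. -/

/-- `f` takes on `V_*` the values of the harmonic function with boundary values `u`. -/
def HasHarmonicValues {N : ℕ} (p : Fin (N + 1) → EuclideanSpace ℝ (Fin N)) (f : gasket p → ℝ)
    (u : Fin (N + 1) → ℝ) : Prop :=
  ∀ w, cellValues p f w = restrict w u

theorem hasHarmonicValues_harmonicLimit {N : ℕ} {p : Fin (N + 1) → EuclideanSpace ℝ (Fin N)}
    (hp : AffineIndependent ℝ p) (u : Fin (N + 1) → ℝ) :
    HasHarmonicValues p (harmonicLimit hp u) u := by
  intro w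
  induction w generalizing u with
  | nil => exact funext fun i => harmonicLimit_vertex hp u i
  | cons i w ih =>
    rw [restrict, ← ih]
    funext k
    exact harmonicLimit_cellMap hp u i (cellMap p w (vertex p k))

theorem HasHarmonicValues.comp {N : ℕ} {p : Fin (N + 1) → EuclideanSpace ℝ (Fin N)}
    {f : gasket p → ℝ} {u : Fin (N + 1) → ℝ} (hf : HasHarmonicValues p f u)
    (w : List (Fin (N + 1))) : HasHarmonicValues p (f ∘ cellMap p w) (restrict w u) := by
  intro w'
  rw [← restrict_append, ← hf]
  funext k
  simp only [cellValues, Function.comp_apply, cellMap_append]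

theorem HasHarmonicValues.normForm_eq {N : ℕ} {p : Fin (N + 1) → EuclideanSpace ℝ (Fin N)}
    {f : gasket p → ℝ} {u : Fin (N + 1) → ℝ} (hf : HasHarmonicValues p f u) (m : ℕ) :
    normForm p m f f = baseForm u u := by
  induction m generalizing f u with
  | zero => rw [normForm_zero, hf]; rfl
  | succ m ih =>
    have h1 : ∀ i, normForm p m (f ∘ cellMap p [i]) (f ∘ cellMap p [i]) =
        baseForm (step i u) (step i u) := fun i => ih (hf.comp [i])
    simp only [normForm_succ, h1]
    rw [sum_baseForm_step_self, inv_mul_cancel_left₀ (ratio_pos N).ne']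

theorem HasHarmonicValues.mem_formDomain {N : ℕ} {p : Fin (N + 1) → EuclideanSpace ℝ (Fin N)}
    {f : C(gasket p, ℝ)} {u : Fin (N + 1) → ℝ} (hf : HasHarmonicValues p f u) :
    f ∈ formDomain p :=
  energyStar_lt_top fun m => (hf.normForm_eq m).le

theorem HasHarmonicValues.energyStar_eq {N : ℕ} {p : Fin (N + 1) → EuclideanSpace ℝ (Fin N)}
    {f : C(gasket p, ℝ)} {u : Fin (N + 1) → ℝ} (hf : HasHarmonicValues p f u) :
    (energyStar p f).toReal = baseForm u u := by
  refine tendsto_nhds_unique (tendsto_normForm_self hf.mem_formDomain) ?_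
  simp only [hf.normForm_eq]
  exact tendsto_const_nhds

/-- Minimal energy forces equality in Pythagoras, so on each first-level cell the difference from
`step` is constant, and it vanishes at the fixed vertex. The energies in these cells are then
minimal as well, and the argument repeats. -/
theorem hasHarmonicValues_of_normForm_le {N : ℕ} {p : Fin (N + 1) → EuclideanSpace ℝ (Fin N)}
    {f : gasket p → ℝ}
    (hf : ∀ m, normForm p m f f ≤ baseForm (cellValues p f []) (cellValues p f [])) :
    HasHarmonicValues p f (cellValues p f []) := by
  intro w
  induction w generalizing f with
  | nil => rfl
  | cons i w ih =>
    have h0 : ∀ k m, baseForm (cellValues p f [k]) (cellValues p f [k]) ≤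
        normForm p m (f ∘ cellMap p [k]) (f ∘ cellMap p [k]) := fun k m => by
      have h := normForm_monotone p (f ∘ cellMap p [k]) (Nat.zero_le m)
      simp only [normForm_zero] at h
      exact h
    have h1 : ∀ m, ∑ k, normForm p m (f ∘ cellMap p [k]) (f ∘ cellMap p [k]) ≤
        ratio N * baseForm (cellValues p f []) (cellValues p f []) := fun m => by
      have h := hf (m + 1)
      rwa [normForm_succ, ← div_eq_inv_mul, div_le_iff₀ (ratio_pos N), mul_comm] at h
    have h2 := sum_baseForm_sub_step (cellValues p f [·]) (cellValues_singleton_symm p f)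
    rw [cellValues_singleton_self] at h2
    have h3 : ∑ k, baseForm (cellValues p f [k]) (cellValues p f [k]) ≤
        ratio N * baseForm (cellValues p f []) (cellValues p f []) :=
      (Finset.sum_le_sum fun k _ => h0 k 0).trans (h1 0)
    have h4 : ratio N * baseForm (cellValues p f []) (cellValues p f []) ≤
        ∑ k, baseForm (cellValues p f [k]) (cellValues p f [k]) := by
      have h := ratio_mul_baseForm_le (cellValues p f [·]) (cellValues_singleton_symm p f)
      rwa [cellValues_singleton_self] at h
    have h5 : cellValues p f [i] = step i (cellValues p f []) := by
      have h6 : ∑ k, baseForm (cellValues p f [k] - step k (cellValues p f []))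
          (cellValues p f [k] - step k (cellValues p f [])) = 0 := by linarith
      rw [Finset.sum_eq_zero_iff_of_nonneg fun k _ => baseForm_self_nonneg _] at h6
      have h7 := eq_of_baseForm_eq_zero (h6 i (Finset.mem_univ i))
      funext k
      have h8 := h7 k i
      have h9 : cellValues p f [i] i = cellValues p f [] i :=
        congrFun (cellValues_singleton_self p f) i
      simp only [Pi.sub_apply, step_self, h9, sub_self] at h8
      linarith
    have h10 := ih (f := f ∘ cellMap p [i]) fun m => by
      -- Each term dominates its minimum and the sums agree, so all terms agree.
      have h11 : ∀ k ∈ Finset.univ, baseForm (cellValues p f [k]) (cellValues p f [k]) =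
          normForm p m (f ∘ cellMap p [k]) (f ∘ cellMap p [k]) :=
        (Finset.sum_eq_sum_iff_of_le fun k _ => h0 k m).mp
          (le_antisymm (Finset.sum_le_sum fun k _ => h0 k m) ((h1 m).trans h4))
      exact (h11 i (Finset.mem_univ i)).symm.le
    rw [restrict, ← h5]
    exact h10

theorem baseForm_le_energyStar {N : ℕ} {p : Fin (N + 1) → EuclideanSpace ℝ (Fin N)}
    {f : gasket p → ℝ} (hf : energyStar p f < ∞) :
    baseForm (cellValues p f []) (cellValues p f []) ≤ (energyStar p f).toReal := by
  have h := normForm_le_energyStar hf 0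
  rwa [normForm_zero] at h

theorem HasHarmonicValues.isHarmonicExtension {N : ℕ}
    {p : Fin (N + 1) → EuclideanSpace ℝ (Fin N)} {f : C(gasket p, ℝ)} {u : Fin (N + 1) → ℝ}
    (hf : HasHarmonicValues p f u) : IsHarmonicExtension p u f := by
  refine ⟨hf.mem_formDomain, fun i => congrFun (hf []) i, fun g hg hgu => ?_⟩
  rw [energy_self hf.mem_formDomain, energy_self hg, hf.energyStar_eq]
  have h1 : cellValues p g [] = u := funext hgu
  have h2 := baseForm_le_energyStar hg
  rwa [h1] at h2

theorem IsHarmonicExtension.hasHarmonicValues {N : ℕ}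
    {p : Fin (N + 1) → EuclideanSpace ℝ (Fin N)} (hp : AffineIndependent ℝ p)
    {f : C(gasket p, ℝ)} {u : Fin (N + 1) → ℝ}
    (hf : IsHarmonicExtension p u f) : HasHarmonicValues p f u := by
  obtain ⟨hf1, hf2, hf3⟩ := hf
  have h1 : cellValues p f [] = u := funext hf2
  have hv := hasHarmonicValues_harmonicLimit hp u
  have h2 := hf3 (harmonicLimit hp u) hv.mem_formDomain (harmonicLimit_vertex hp u)
  rw [energy_self hf1, energy_self hv.mem_formDomain, hv.energyStar_eq] at h2
  rw [← h1] at h2 ⊢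
  exact hasHarmonicValues_of_normForm_le fun m => (normForm_le_energyStar hf1 m).trans h2

theorem hasHarmonicValues_harmonicExtension {N : ℕ}
    {p : Fin (N + 1) → EuclideanSpace ℝ (Fin N)} (hp : AffineIndependent ℝ p)
    (u : Fin (N + 1) → ℝ) : HasHarmonicValues p (harmonicExtension p u) u :=
  IsHarmonicExtension.hasHarmonicValues hp (Classical.epsilon_spec (p := IsHarmonicExtension p u)
    ⟨_, (hasHarmonicValues_harmonicLimit hp u).isHarmonicExtension⟩)

/-! ### Energy measures as weak limits. -/

/-- `𝓕` as a subalgebra of `C(K)`. -/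
def formAlgebra {N : ℕ} (p : Fin (N + 1) → EuclideanSpace ℝ (Fin N)) :
    Subalgebra ℝ C(gasket p, ℝ) where
  carrier := formDomain p
  mul_mem' := mul_mem_formDomain
  add_mem' := add_mem_formDomain
  algebraMap_mem' c := const_mem_formDomain p c

theorem formAlgebra_separatesPoints {N : ℕ} {p : Fin (N + 1) → EuclideanSpace ℝ (Fin N)}
    (hp : AffineIndependent ℝ p) : (formAlgebra p).SeparatesPoints := by
  intro x y hxy
  by_contra! hcon
  refine hxy (eq_of_harmonicLimit_eq hp fun u => ?_)
  exact hcon _ ⟨harmonicLimit hp u,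
    (hasHarmonicValues_harmonicLimit hp u).mem_formDomain, rfl⟩

theorem integrable_continuousMap {N : ℕ} {p : Fin (N + 1) → EuclideanSpace ℝ (Fin N)}
    (ν : Measure (gasket p)) [IsFiniteMeasure ν] (g : C(gasket p, ℝ)) : Integrable g ν :=
  .of_bound g.continuous.aestronglyMeasurable ‖g‖ (ae_of_all _ g.norm_coe_le_norm)

/-- Stone–Weierstrass: on the dense algebra `𝓕` the limit is the definition, and both sides are
bounded in the sup norm. -/
theorem IsEnergyMeasure.tendsto_massForm {N : ℕ} {p : Fin (N + 1) → EuclideanSpace ℝ (Fin N)}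
    (hp : AffineIndependent ℝ p) {f : C(gasket p, ℝ)} (hf : f ∈ formDomain p)
    {ν : Measure (gasket p)} (hν : IsEnergyMeasure p f ν) (g : C(gasket p, ℝ)) :
    Tendsto (fun m => massForm p m f g) atTop (𝓝 (∫ x, g x ∂ν)) := by
  obtain ⟨hfin, hν⟩ := hν
  rw [Metric.tendsto_atTop]
  intro ε hε
  set E := (energyStar p f).toReal with hE
  have hE0 : 0 ≤ E := ENNReal.toReal_nonneg
  -- Bounds the total error per unit of `‖g' - g‖`: `2E` from `massForm` and `ν(K)` from the
  -- integral; the `1` keeps `C` positive.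
  set C := 2 * E + ν.real Set.univ + 1 with hC
  have hν0 : 0 ≤ ν.real Set.univ := measureReal_nonneg
  have hC0 : 0 < C := by positivity
  obtain ⟨⟨g', hg'⟩, hgg⟩ := ContinuousMap.exists_mem_subalgebra_near_continuousMap_of_separatesPoints
    (formAlgebra p) (formAlgebra_separatesPoints hp) g (ε / (2 * C)) (by positivity)
  have hlim := Gasket.tendsto_massForm hf hg'
  rw [← hν g' hg', Metric.tendsto_atTop] at hlim
  obtain ⟨n, hn⟩ := hlim (ε / 2) (by positivity)
  refine ⟨n, fun m hm => ?_⟩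
  have h1 : |massForm p m f (g' - g : C(gasket p, ℝ))| ≤ 2 * ‖g' - g‖ * E := abs_massForm_le hf _ m
  have h2 : massForm p m f g' = massForm p m f g + massForm p m f (g' - g : C(gasket p, ℝ)) := by
    rw [← massForm_add]
    congr 1
    funext x
    simp
  have h3 : |∫ x, g' x ∂ν - ∫ x, g x ∂ν| ≤ ‖g' - g‖ * ν.real Set.univ := by
    rw [← integral_sub (integrable_continuousMap ν g') (integrable_continuousMap ν g)]
    exact norm_integral_le_of_norm_le_const (ae_of_all _ (g' - g).norm_coe_le_norm)
  have h4 := hn m hm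
  rw [Real.dist_eq] at h4 ⊢
  have h5 : ‖g' - g‖ * (2 * E + ν.real Set.univ) ≤ ε / 2 := by
    have : ‖g' - g‖ * (2 * E + ν.real Set.univ) ≤ ε / (2 * C) * C :=
      mul_le_mul hgg.le (by rw [hC]; linarith) (by positivity) (by positivity)
    refine this.trans (le_of_eq ?_)
    field_simp
  rw [abs_lt] at h4 ⊢
  rw [abs_le] at h1 h3
  constructor <;> linarith [h1.1, h1.2, h3.1, h3.2, h4.1, h4.2]

/-- A limit along a nonprincipal ultrafilter exists for every continuous `g`, since `massForm` is
bounded. It is a positive linear functional, to which Riesz representation applies. On `𝓕` the true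
limit exists and coincides with it. -/
theorem exists_isEnergyMeasure {N : ℕ} {p : Fin (N + 1) → EuclideanSpace ℝ (Fin N)}
    {f : C(gasket p, ℝ)} (hf : f ∈ formDomain p) : ∃ ν, IsEnergyMeasure p f ν := by
  have h1 : ∀ g : C(gasket p, ℝ), ∃ L, Tendsto (fun m => massForm p m f g)
      (hyperfilter ℕ : Filter ℕ) (𝓝 L) := by
    intro g
    obtain ⟨L, -, hL⟩ := isCompact_Icc.ultrafilter_le_nhds
      ((hyperfilter ℕ).map fun m => massForm p m f g)
      (s := Set.Icc (-(2 * ‖g‖ * (energyStar p f).toReal)) (2 * ‖g‖ * (energyStar p f).toReal)) <| by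
      rw [le_principal_iff]
      exact mem_map.mpr (Eventually.of_forall fun m => abs_le.mp (abs_massForm_le hf g m))
    exact ⟨L, hL⟩
  choose L hL using h1
  let Λ₀ : CompactlySupportedContinuousMap (gasket p) ℝ →ₗ[ℝ] ℝ :=
    { toFun := fun g => L g.toContinuousMap
      map_add' := fun g g' => by
        refine tendsto_nhds_unique (hL _) (((hL _).add (hL _)).congr fun m => ?_)
        exact (massForm_add p m f g g').symm
      map_smul' := fun c g => by
        refine tendsto_nhds_unique (hL _) (((hL _).const_mul c).congr fun m => ?_)
        exact (massForm_smul p m f c g).symm }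
  let Λ := PositiveLinearMap.mk₀ Λ₀ fun g hg => by
    refine ge_of_tendsto' (hL g.toContinuousMap) fun m => ?_
    have h := massForm_mono p m f (g := fun _ => 0) (g' := g) hg
    rw [massForm_const] at h
    simpa using h
  refine ⟨RealRMK.rieszMeasure Λ, inferInstance, fun g hg => ?_⟩
  have h2 := RealRMK.integral_rieszMeasure Λ (CompactlySupportedContinuousMap.continuousMapEquiv g)
  refine Eq.trans h2 (tendsto_nhds_unique (hL g) ?_)
  exact (Gasket.tendsto_massForm hf hg).mono_left Nat.hyperfilter_le_atTop

theorem isEnergyMeasure_energyMeasure {N : ℕ} {p : Fin (N + 1) → EuclideanSpace ℝ (Fin N)}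
    {f : C(gasket p, ℝ)} (hf : f ∈ formDomain p) : IsEnergyMeasure p f (energyMeasure p f) :=
  Classical.epsilon_spec (p := IsEnergyMeasure p f) (exists_isEnergyMeasure hf)

/-! ### Energy mass of cells. -/

/-- The energy measure of the cell `K_w` for the harmonic function with boundary values `u`. -/
def cellMass {N : ℕ} (u : Fin (N + 1) → ℝ) (w : List (Fin (N + 1))) : ℝ :=
  2 * ((ratio N)⁻¹ ^ w.length * baseForm (restrict w u) (restrict w u))

theorem cellMass_nonneg {N : ℕ} (u : Fin (N + 1) → ℝ) (w : List (Fin (N + 1))) :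
    0 ≤ cellMass u w :=
  mul_nonneg zero_le_two (mul_nonneg (pow_nonneg (inv_nonneg.mpr (ratio_pos N).le) _)
    (baseForm_self_nonneg _))

theorem cellMass_append {N : ℕ} (u : Fin (N + 1) → ℝ) (w w' : List (Fin (N + 1))) :
    cellMass u (w ++ w') = (ratio N)⁻¹ ^ w.length * cellMass (restrict w u) w' := by
  rw [cellMass, cellMass, restrict_append, List.length_append, pow_add]
  ring

theorem wordSum_cellMass {N : ℕ} (n : ℕ) (u : Fin (N + 1) → ℝ) :
    wordSum n (cellMass u) = 2 * baseForm u u := by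
  induction n generalizing u with
  | zero => simp [wordSum_zero, cellMass, restrict]
  | succ n ih =>
    have h : ∀ i w, cellMass u (i :: w) = (ratio N)⁻¹ * cellMass (step i u) w := fun i w => by
      simpa [restrict] using cellMass_append u [i] w
    rw [wordSum_succ]
    simp only [h, wordSum_const_mul]
    have h2 : ∀ i, (wordSum n fun w => cellMass (step i u) w) =
      2 * baseForm (step i u) (step i u) := fun i => ih (step i u)
    simp only [h2, ← Finset.mul_sum, sum_baseForm_step_self]
    have := (ratio_pos N).ne'
    field_simp

/-- The form shrinks by `r²` per letter and renormalization restores only one factor `r`. Hence the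
mass of cells shrinking to a vertex tends to `0`. -/
theorem cellMass_append_replicate_le {N : ℕ} (u : Fin (N + 1) → ℝ) (w : List (Fin (N + 1)))
    (k : ℕ) (j : Fin (N + 1)) :
    cellMass u (w ++ List.replicate k j) ≤ ratio N ^ k * cellMass u w := by
  rw [cellMass_append, cellMass, cellMass, List.length_replicate, mul_left_comm,
    mul_left_comm (ratio N ^ k)]
  refine mul_le_mul_of_nonneg_left ?_ zero_le_two
  rw [mul_left_comm (ratio N ^ k)]
  have h0 := ratio_pos N
  refine mul_le_mul_of_nonneg_left ?_ (by positivity)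
  rw [inv_pow, ← div_eq_inv_mul, div_le_iff₀ (by positivity)]
  refine (baseForm_restrict_replicate_le j k _).trans (le_of_eq ?_)
  ring

theorem wordSum_ite_eq {N : ℕ} (v : List (Fin (N + 1))) (c : ℝ) :
    (wordSum v.length fun w => if w = v then c else 0) = c := by
  induction v with
  | nil => simp [wordSum_zero]
  | cons i v ih =>
    rw [List.length_cons, wordSum_succ, Finset.sum_eq_single i]
    · simpa using ih
    · intro b _ hb
      simp [hb, wordSum]
    · simp

theorem wordSum_le_sum_replicate {N : ℕ} (k : ℕ) {F G : List (Fin (N + 1)) → ℝ}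
    (hG : ∀ w, 0 ≤ G w) (hF : ∀ w, F w ≤ G w)
    (h : ∀ w, w.length = k → (∀ j, w ≠ List.replicate k j) → F w ≤ 0) :
    wordSum k F ≤ ∑ j, G (List.replicate k j) := by
  have h1 : ∑ j, G (List.replicate k j) =
      ∑ j, wordSum k fun w => if w = List.replicate k j then G (List.replicate k j) else 0 := by
    refine Finset.sum_congr rfl fun j _ => ?_
    have := wordSum_ite_eq (List.replicate k j) (G (List.replicate k j))
    rw [List.length_replicate] at this
    exact this.symm
  rw [h1]
  unfold wordSum
  rw [Finset.sum_comm]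
  refine Finset.sum_le_sum fun w _ => ?_
  have h2 : ∀ j ∈ Finset.univ, 0 ≤
      if List.ofFn w = List.replicate k j then G (List.replicate k j) else 0 := fun j _ => by
    split_ifs
    · exact hG _
    · exact le_rfl
  by_cases hw : ∀ j, List.ofFn w ≠ List.replicate k j
  · exact (h _ (by simp) hw).trans (Finset.sum_nonneg h2)
  · push Not at hw
    obtain ⟨j, hj⟩ := hw
    refine le_trans ?_ (Finset.single_le_sum h2 (Finset.mem_univ j))
    rw [if_pos hj, hj]
    exact hF _

theorem isClosed_iUnion_cell {N : ℕ} (p : Fin (N + 1) → EuclideanSpace ℝ (Fin N)) (n : ℕ)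
    (A : Set (List (Fin (N + 1)))) : IsClosed (⋃ w ∈ {w ∈ A | w.length = n}, cell p w) :=
  ((List.finite_length_eq (Fin (N + 1)) n).subset fun _ h => h.2).isClosed_biUnion
    fun w _ => isClosed_cell p w

-- A thickened indicator of the closed union is `1` on the selected cells, so each of them
-- contributes at least its full mass to `massForm` at every later level. Then let the level grow
-- and the thickening shrink.
open Classical in
theorem IsEnergyMeasure.wordSum_cellMass_le {N : ℕ} {p : Fin (N + 1) → EuclideanSpace ℝ (Fin N)}
    (hp : AffineIndependent ℝ p) {f : C(gasket p, ℝ)} {u : Fin (N + 1) → ℝ}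
    (hf : HasHarmonicValues p f u) {ν : Measure (gasket p)} (hν : IsEnergyMeasure p f ν) (n : ℕ)
    (A : Set (List (Fin (N + 1)))) :
    (wordSum n fun w => if w ∈ A then cellMass u w else 0) ≤
      ν.real (⋃ w ∈ {w ∈ A | w.length = n}, cell p w) := by
  have hfin := hν.1
  have hpos : ∀ m : ℕ, (0 : ℝ) < 1 / ((m : ℝ) + 1) := fun m => by positivity
  refine ge_of_tendsto' (tendsto_integral_thickenedIndicator_of_isClosed ν
    (isClosed_iUnion_cell p n A) hpos tendsto_one_div_add_atTop_nhds_zero_nat) fun l => ?_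
  set F := ⋃ w ∈ {w ∈ A | w.length = n}, cell p w with hF
  let g : C(gasket p, ℝ) := ⟨fun x => (thickenedIndicator (hpos l) F x : ℝ),
    NNReal.continuous_coe.comp (thickenedIndicator (hpos l) F).continuous⟩
  refine ge_of_tendsto (hν.tendsto_massForm hp hf.mem_formDomain g) ?_
  filter_upwards [eventually_ge_atTop n] with m hm
  obtain ⟨k, rfl⟩ := Nat.exists_eq_add_of_le hm
  rw [massForm_add_length, ← wordSum_const_mul]
  refine wordSum_le fun w hw => ?_
  have h0 : (0 : ℝ) ≤ (ratio N)⁻¹ ^ n := pow_nonneg (inv_nonneg.mpr (ratio_pos N).le) _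
  split_ifs with hwA
  · have h1 := massForm_mono p k (f ∘ cellMap p w) (g := fun _ => 1) (g' := g ∘ cellMap p w)
      fun x => by
        have hx : cellMap p w x ∈ F := Set.mem_biUnion ⟨hwA, hw⟩ ⟨x, rfl⟩
        have h2 := thickenedIndicator_one (hpos l) F hx
        change (1 : ℝ) ≤ (thickenedIndicator (hpos l) F (cellMap p w x) : ℝ)
        rw [h2]
        simp
    rw [massForm_const, (hf.comp w).normForm_eq] at h1
    rw [cellMass, hw, mul_left_comm]
    refine mul_le_mul_of_nonneg_left ?_ h0
    linarith
  · have h1 := massForm_mono p k (f ∘ cellMap p w) (g := fun _ => 0) (g' := g ∘ cellMap p w)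
      fun x => NNReal.coe_nonneg _
    rw [massForm_const] at h1
    refine mul_nonneg h0 ?_
    linarith

theorem IsEnergyMeasure.real_univ {N : ℕ} {p : Fin (N + 1) → EuclideanSpace ℝ (Fin N)}
    (hp : AffineIndependent ℝ p) {f : C(gasket p, ℝ)} {u : Fin (N + 1) → ℝ}
    (hf : HasHarmonicValues p f u) {ν : Measure (gasket p)} (hν : IsEnergyMeasure p f ν) :
    ν.real Set.univ = 2 * baseForm u u := by
  have h1 := hν.tendsto_massForm hp hf.mem_formDomain (ContinuousMap.const _ 1)
  have h2 : ∀ m, massForm p m f (ContinuousMap.const (gasket p) (1 : ℝ)) = 2 * baseForm u u :=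
    fun m => by
      have := massForm_const p m f 1
      rw [hf.normForm_eq, mul_one] at this
      exact this
  simp only [h2] at h1
  have h3 := tendsto_nhds_unique h1 tendsto_const_nhds
  simpa using h3

open Classical in
/-- The energy measure of a harmonic function on cells. -/
theorem IsEnergyMeasure.real_cell {N : ℕ} {p : Fin (N + 1) → EuclideanSpace ℝ (Fin N)}
    (hp : AffineIndependent ℝ p) {f : C(gasket p, ℝ)} {u : Fin (N + 1) → ℝ}
    (hf : HasHarmonicValues p f u) {ν : Measure (gasket p)} (hν : IsEnergyMeasure p f ν)
    (w : List (Fin (N + 1))) : ν.real (cell p w) = cellMass u w := by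
  have hfin := hν.1
  apply le_antisymm
  · have key : ∀ k : ℕ, ν.real (cell p w) ≤
        cellMass u w + ((N : ℝ) + 1) * ratio N ^ k * (2 * baseForm u u) := by
      intro k
      -- The lower bound for the cells that avoid `K_w`, subtracted from the known total mass, gives
      -- the upper bound for `K_w`.
      set A : Set (List (Fin (N + 1))) := {σ | Disjoint (cell p σ) (cell p w)} with hA
      have h1 := hν.wordSum_cellMass_le hp hf (w.length + k) A
      have h2 : ν.real (⋃ σ ∈ {σ ∈ A | σ.length = w.length + k}, cell p σ) + ν.real (cell p w) ≤
          ν.real Set.univ := by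
        rw [← measureReal_union ?_ (isClosed_cell p w).measurableSet (measure_ne_top _ _)
          (measure_ne_top _ _)]
        · exact measureReal_mono (Set.subset_univ _)
        · exact Set.disjoint_iUnion₂_left.mpr fun σ hσ => hσ.1
      rw [hν.real_univ hp hf, ← wordSum_cellMass (w.length + k) u] at h2
      have h3 : ν.real (cell p w) ≤
          wordSum (w.length + k) fun σ => cellMass u σ - if σ ∈ A then cellMass u σ else 0 := by
        rw [wordSum_sub]
        linarith
      refine h3.trans ?_
      rw [wordSum_add_length]
      -- For `τ = w` the subcells have total mass `cellMass u w`. For `τ ≠ w` only the corner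
      -- subcells `τ j^k` can touch `K_w`: at most `N + 1` of them, each of mass at most `r^k` times
      -- that of `τ`.
      have h4 : ∀ τ : List (Fin (N + 1)), τ.length = w.length → (wordSum k fun τ' =>
          cellMass u (τ ++ τ') - if τ ++ τ' ∈ A then cellMass u (τ ++ τ') else 0) ≤
          (if τ = w then cellMass u w else 0) + ((N : ℝ) + 1) * ratio N ^ k * cellMass u τ := by
        intro τ hτ
        have hnn : 0 ≤ ((N : ℝ) + 1) * ratio N ^ k * cellMass u τ :=
          mul_nonneg (mul_nonneg (by positivity) (pow_nonneg (ratio_pos N).le k))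
            (cellMass_nonneg u τ)
        have hle : ∀ τ', (cellMass u (τ ++ τ') -
            if τ ++ τ' ∈ A then cellMass u (τ ++ τ') else 0) ≤ cellMass u (τ ++ τ') := fun τ' => by
          have := cellMass_nonneg u (τ ++ τ')
          split_ifs <;> linarith
        split_ifs with hτw
        · subst hτw
          refine le_trans (wordSum_le fun τ' _ => hle τ') ?_
          simp only [cellMass_append, wordSum_const_mul]
          have h5 := wordSum_cellMass k (restrict τ u)
          have h6 : (wordSum k fun w => cellMass (restrict τ u) w) =
            wordSum k (cellMass (restrict τ u)) := rfl
          rw [h6, h5, mul_left_comm, ← cellMass]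
          linarith
        · rw [zero_add]
          refine (wordSum_le_sum_replicate k (fun τ' => cellMass_nonneg u (τ ++ τ')) hle ?_).trans ?_
          · intro τ' hk hτ'
            by_contra! hcon
            have h7 : τ ++ τ' ∉ A := fun h => by rw [if_pos h, sub_self] at hcon; exact hcon.false
            obtain ⟨_, ⟨x, rfl⟩, y, hy⟩ := Set.not_disjoint_iff.mp h7
            rw [cellMap_append] at hy
            obtain ⟨j, hj⟩ := eq_vertex_of_cellMap_eq hp hτ hτw hy.symm
            exact hτ' j (hk ▸ (cellMap_eq_vertex hp hj).1)
          · refine (Finset.sum_le_sum fun j _ => cellMass_append_replicate_le u τ k j).trans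
              (le_of_eq ?_)
            simp [mul_assoc]
      refine (wordSum_le h4).trans (le_of_eq ?_)
      rw [wordSum_add, wordSum_ite_eq, wordSum_const_mul]
      congr 2
      exact wordSum_cellMass _ u
    have hlim : Tendsto (fun k : ℕ => cellMass u w +
        ((N : ℝ) + 1) * ratio N ^ k * (2 * baseForm u u)) atTop (𝓝 (cellMass u w)) := by
      have := (((tendsto_pow_atTop_nhds_zero_of_lt_one (ratio_pos N).le
        (ratio_lt_one N)).const_mul ((N : ℝ) + 1)).mul_const (2 * baseForm u u)).const_add
          (cellMass u w)
      simpa using this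
    exact ge_of_tendsto' hlim key
  · have h1 := hν.wordSum_cellMass_le hp hf w.length {w}
    simp only [Set.mem_singleton_iff] at h1
    have h2 : (wordSum w.length fun σ => if σ = w then cellMass u σ else 0) = cellMass u w := by
      rw [← wordSum_ite_eq w (cellMass u w)]
      refine wordSum_congr fun σ _ => ?_
      split_ifs with h
      · rw [h]
      · rfl
    rw [h2] at h1
    refine h1.trans (measureReal_mono ?_)
    exact Set.iUnion₂_subset fun σ hσ => by rw [hσ.1]

theorem energyMeasure_real_cell {N : ℕ} {p : Fin (N + 1) → EuclideanSpace ℝ (Fin N)}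
    (hp : AffineIndependent ℝ p) {f : C(gasket p, ℝ)} {u : Fin (N + 1) → ℝ}
    (hf : HasHarmonicValues p f u) (w : List (Fin (N + 1))) :
    (energyMeasure p f).real (cell p w) = cellMass u w :=
  (isEnergyMeasure_energyMeasure hf.mem_formDomain).real_cell hp hf w

theorem kusuokaMeasure_real_cell {N : ℕ} {p : Fin (N + 1) → EuclideanSpace ℝ (Fin N)}
    (hp : AffineIndependent ℝ p) (w : List (Fin (N + 1))) :
    (kusuokaMeasure p).real (cell p w) = ∑ k, cellMass (Pi.single k 1) w := by
  have hv := fun k : Fin (N + 1) => hasHarmonicValues_harmonicExtension hp (Pi.single k 1)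
  have hfin := fun k => (isEnergyMeasure_energyMeasure (hv k).mem_formDomain).1
  rw [Measure.real, kusuokaMeasure, Measure.finsetSum_apply,
    ENNReal.toReal_sum fun k _ => (measure_lt_top _ _).ne]
  exact Finset.sum_congr rfl fun k _ => energyMeasure_real_cell hp (hv k) w

/-- Each restriction divides the form by at most `(N+3)²`, and the form of `e_k` is `N`. -/
theorem sum_cellMass_single_pos {N : ℕ} (hN : 0 < N) (w : List (Fin (N + 1))) :
    0 < ∑ k, cellMass (Pi.single k 1) w := by
  refine Finset.sum_pos (fun k _ => ?_) Finset.univ_nonempty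
  have h1 := baseForm_le_baseForm_restrict w (Pi.single k 1 : Fin (N + 1) → ℝ)
  have h2 : baseForm (Pi.single k 1 : Fin (N + 1) → ℝ) (Pi.single k 1) = N := by
    rw [baseForm_eq_sub]
    simp [Pi.single_apply]
  rw [h2] at h1
  have h3 : (0 : ℝ) < N := Nat.cast_pos.mpr hN
  have h4 := pos_of_mul_pos_right (h3.trans_le h1) (by positivity)
  have := ratio_pos N
  unfold cellMass
  positivity

/-! ### The density at a vertex. -/

/-- The pointwise density at the vertex `j` of the cell `K_w`. -/
def vertexDensity {N : ℕ} (u : Fin (N + 1) → ℝ) (w : List (Fin (N + 1))) (j : Fin (N + 1)) : ℝ :=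
  flux j (restrict w u) ^ 2 / ∑ k, flux j (restrict w (Pi.single k 1)) ^ 2

/-- A linear functional of the restriction to a cell does not vanish on all `e_k`, unless it is
zero. -/
theorem sum_sq_restrict_pos {N : ℕ} (w : List (Fin (N + 1))) (φ : (Fin (N + 1) → ℝ) →ₗ[ℝ] ℝ)
    {v : Fin (N + 1) → ℝ} (hv : φ v ≠ 0) :
    0 < ∑ k, φ (restrict w (Pi.single k 1)) ^ 2 := by
  by_contra! hcon
  have h0 : ∑ k, φ (restrict w (Pi.single k 1)) ^ 2 = 0 :=
    le_antisymm hcon (Finset.sum_nonneg fun k _ => sq_nonneg _)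
  rw [Finset.sum_eq_zero_iff_of_nonneg fun k _ => sq_nonneg _] at h0
  obtain ⟨u, rfl⟩ := restrict_surjective w v
  let R : (Fin (N + 1) → ℝ) →ₗ[ℝ] (Fin (N + 1) → ℝ) :=
    { toFun := restrict w, map_add' := restrict_add w, map_smul' := restrict_smul w }
  apply hv
  have h1 : φ ∘ₗ R = 0 := by
    refine LinearMap.pi_ext' fun k => LinearMap.ext_ring ?_
    simpa [R] using h0 k (Finset.mem_univ k)
  exact congrArg (· u) h1

/-- The normal derivative at `j` as a linear functional. -/
def fluxLinear {N : ℕ} (j : Fin (N + 1)) : (Fin (N + 1) → ℝ) →ₗ[ℝ] ℝ where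
  toFun := flux j
  map_add' := flux_add j
  map_smul' := flux_smul j

theorem sum_sq_flux_pos {N : ℕ} (hN : 0 < N) (w : List (Fin (N + 1))) (j : Fin (N + 1)) :
    0 < ∑ k, flux j (restrict w (Pi.single k 1)) ^ 2 := by
  refine sum_sq_restrict_pos w (fluxLinear j) (v := Pi.single j 1) ?_
  have : (0 : ℝ) < N := Nat.cast_pos.mpr hN
  simp [fluxLinear, flux, hN.ne']

theorem tendsto_cellMass_div {N : ℕ} (hN : 0 < N) (u : Fin (N + 1) → ℝ)
    (w : List (Fin (N + 1))) (j : Fin (N + 1)) :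
    Tendsto (fun n : ℕ => cellMass u (w ++ List.replicate n j) /
      ∑ k, cellMass (Pi.single k 1) (w ++ List.replicate n j)) atTop
      (𝓝 (vertexDensity u w j)) := by
  have hN' : (0 : ℝ) < N := Nat.cast_pos.mpr hN
  -- Decay per letter of the part of the form not carried by the flux, relative to `flux²/N`. The
  -- powers of `r` are common to numerator and denominator and cancel.
  set q : ℝ := (((N : ℝ) + 1) ^ 2)⁻¹ with hq
  have hq0 : 0 ≤ q := by positivity
  have hq1 : q < 1 := inv_lt_one_of_one_lt₀ (by nlinarith)
  set G : ℕ → (Fin (N + 1) → ℝ) → ℝ := fun n u => flux j (restrict w u) ^ 2 / N +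
    q ^ n * (baseForm (restrict w u) (restrict w u) - flux j (restrict w u) ^ 2 / N) with hG
  have h1 : ∀ n u, cellMass u (w ++ List.replicate n j) =
      (2 * ((ratio N)⁻¹ ^ (w.length + n) * (ratio N ^ 2) ^ n)) * G n u := fun n u => by
    rw [cellMass, restrict_append, baseForm_restrict_replicate hN, List.length_append,
      List.length_replicate, hG, hq]
    ring
  have h2 : ∀ n, 2 * ((ratio N)⁻¹ ^ (w.length + n) * (ratio N ^ 2) ^ n) ≠ 0 := fun n => by
    have := ratio_pos N
    positivity
  have h3 : ∀ u, Tendsto (fun n => G n u) atTop (𝓝 (flux j (restrict w u) ^ 2 / N)) := fun u => by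
    have := ((tendsto_pow_atTop_nhds_zero_of_lt_one hq0 hq1).mul_const
      (baseForm (restrict w u) (restrict w u) - flux j (restrict w u) ^ 2 / N)).const_add
      (flux j (restrict w u) ^ 2 / N)
    simpa using this
  have hpos := sum_sq_flux_pos hN w j
  have h4 := (h3 u).div (tendsto_finsetSum Finset.univ fun k _ => h3 (Pi.single k 1))
    (by rw [← Finset.sum_div]; positivity)
  rw [← Finset.sum_div, div_div_div_cancel_right₀ hN'.ne'] at h4
  refine h4.congr fun n => ?_
  simp only [h1, ← Finset.mul_sum]
  rw [mul_div_mul_left _ _ (h2 n)]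
  rfl

/-- Two addresses of the same point define proportional normal derivatives. -/
theorem exists_flux_proportional {N : ℕ} {p : Fin (N + 1) → EuclideanSpace ℝ (Fin N)}
    (hp : AffineIndependent ℝ p) {w w' : List (Fin (N + 1))} {j j' : Fin (N + 1)}
    (h : cellMap p w (vertex p j) = cellMap p w' (vertex p j')) :
    ∃ c : ℝ, c ≠ 0 ∧ ∀ u, flux j (restrict w u) = c * flux j' (restrict w' u) := by
  have hr := (ratio_pos N).ne'
  have key : ∀ (w : List (Fin (N + 1))) (j k : Fin (N + 1)),
      cellMap p w (vertex p j) = vertex p k → j = k ∧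
        ∀ u, flux j (restrict w u) = ratio N ^ w.length * flux k u := by
    intro w j k h
    obtain ⟨h1, h2⟩ := cellMap_eq_vertex hp h
    obtain rfl := vertex_injective hp h2
    refine ⟨rfl, fun u => ?_⟩
    rw [h1, flux_restrict_replicate, List.length_replicate]
  induction w generalizing w' with
  | nil =>
    obtain ⟨rfl, h2⟩ := key w' j' j h.symm
    refine ⟨(ratio N ^ w'.length)⁻¹, inv_ne_zero (pow_ne_zero _ hr), fun u => ?_⟩
    rw [h2, inv_mul_cancel_left₀ (pow_ne_zero _ hr)]
    rfl
  | cons i w ih =>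
    cases w' with
    | nil =>
      obtain ⟨rfl, h2⟩ := key _ j j' h
      exact ⟨_, pow_ne_zero _ hr, h2⟩
    | cons i' w' =>
      rw [cellMap_cons, cellMap_cons p i'] at h
      by_cases hi : i = i'
      · subst hi
        obtain ⟨c, hc, h2⟩ := ih (cellMap_injective p _ h)
        exact ⟨c, hc, fun u => h2 (step i u)⟩
      · obtain ⟨h1, h2⟩ := cellMap_singleton_eq hp hi h
        obtain ⟨rfl, h3⟩ := key w j i' h1
        obtain ⟨rfl, h4⟩ := key w' j' i h2
        -- The sign comes from the opposite fluxes at the junction, the powers of `r` from the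
        -- repeated letters that follow on each side.
        refine ⟨-(ratio N ^ w.length / ratio N ^ w'.length),
          neg_ne_zero.mpr (div_ne_zero (pow_ne_zero _ hr) (pow_ne_zero _ hr)), fun u => ?_⟩
        rw [restrict, restrict, h3, h4, flux_step_of_ne hi, flux_step_of_ne (Ne.symm hi)]
        field_simp
        ring

theorem vertexDensity_congr {N : ℕ} {p : Fin (N + 1) → EuclideanSpace ℝ (Fin N)}
    (hp : AffineIndependent ℝ p) (u : Fin (N + 1) → ℝ) {w w' : List (Fin (N + 1))}
    {j j' : Fin (N + 1)} (h : cellMap p w (vertex p j) = cellMap p w' (vertex p j')) :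
    vertexDensity u w j = vertexDensity u w' j' := by
  obtain ⟨c, hc, h1⟩ := exists_flux_proportional hp h
  simp only [vertexDensity, h1, mul_pow, ← Finset.mul_sum]
  exact mul_div_mul_left _ _ (pow_ne_zero 2 hc)

theorem tendsto_measure_div {N : ℕ} (hN : 0 < N) {p : Fin (N + 1) → EuclideanSpace ℝ (Fin N)}
    (hp : AffineIndependent ℝ p) {h : C(gasket p, ℝ)} {u : Fin (N + 1) → ℝ}
    (hh : HasHarmonicValues p h u) (w : List (Fin (N + 1))) (j : Fin (N + 1)) :
    Tendsto (fun n : ℕ => (energyMeasure p h).real (cell p (w ++ List.replicate n j)) /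
      (kusuokaMeasure p).real (cell p (w ++ List.replicate n j))) atTop
      (𝓝 (vertexDensity u w j)) := by
  simp only [energyMeasure_real_cell hp hh, kusuokaMeasure_real_cell hp]
  exact tendsto_cellMass_div hN u w j

theorem IsPointwiseDensity.eq_vertexDensity {N : ℕ} (hN : 0 < N)
    {p : Fin (N + 1) → EuclideanSpace ℝ (Fin N)}
    (hp : AffineIndependent ℝ p) {h : C(gasket p, ℝ)} {u : Fin (N + 1) → ℝ}
    (hh : HasHarmonicValues p h u) {δ : vertexSet p → ℝ} (hδ : IsPointwiseDensity p h δ)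
    {x : vertexSet p} {w : List (Fin (N + 1))} {j : Fin (N + 1)}
    (hx : (x : gasket p) = cellMap p w (vertex p j)) : δ x = vertexDensity u w j := by
  -- A density is tested on words with at least one letter before the repetition; appending the
  -- letter `j`, which fixes `p_j`, supplies it.
  have h1 : cellMap p (w ++ [j]) (vertex p j) = cellMap p w (vertex p j) := by
    rw [cellMap_append, cellMap_self_vertex]
  rw [← vertexDensity_congr hp u h1]
  exact tendsto_nhds_unique (hδ x w j j (hx.trans h1.symm)) (tendsto_measure_div hN hp hh _ j)

theorem exists_isPointwiseDensity {N : ℕ} (hN : 0 < N)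
    {p : Fin (N + 1) → EuclideanSpace ℝ (Fin N)}
    (hp : AffineIndependent ℝ p) {h : C(gasket p, ℝ)} {u : Fin (N + 1) → ℝ}
    (hh : HasHarmonicValues p h u) : ∃ δ, IsPointwiseDensity p h δ := by
  have hex : ∀ x : vertexSet p, ∃ w i, (x : gasket p) = cellMap p w (vertex p i) := fun x => x.2
  choose W J hWJ using hex
  refine ⟨fun x => vertexDensity u (W x) (J x), fun x w i j hx => ?_⟩
  simp only [vertexDensity_congr hp u ((hWJ x).symm.trans hx)]
  exact tendsto_measure_div hN hp hh _ j

/-! ### Position of the flux along an edge. -/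

/-- The dyadic parameter in `[0, 1]` of the end `e` of the dyadic interval with address `τ`. -/
def dyadicPoint : List Bool → Bool → ℝ
  | [], e => if e then 1 else 0
  | b :: τ, e => if b then (1 + dyadicPoint τ e) / 2 else dyadicPoint τ e / 2

/-- The relative position of the normal derivative at a dyadic point of an edge between those at
the ends of the edge, where `ρ` is the ratio of the weights of the ends. -/
def fluxPosition (N : ℕ) : ℝ → List Bool → Bool → ℝ
  | _, [], e => if e then 1 else 0
  | ρ, b :: τ, e =>
    if b then 1 - ρ / (1 + ρ) * (1 - fluxPosition N ((1 + ρ) / ((N : ℝ) + 1)) τ e)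
    else 1 / (1 + ρ) * fluxPosition N (((N : ℝ) + 1) * ρ / (1 + ρ)) τ e

theorem dyadicPoint_mem_Icc (τ : List Bool) (e : Bool) : dyadicPoint τ e ∈ Set.Icc (0 : ℝ) 1 := by
  induction τ with
  | nil => cases e <;> simp [dyadicPoint]
  | cons b τ ih =>
    obtain ⟨h1, h2⟩ := ih
    cases b <;> simp only [dyadicPoint, Set.mem_Icc] <;> constructor <;> norm_num <;> linarith

/-- The map is increasing in `ρ`, sends `1/N` to `1` and fixes `N`. The map for the right half is
its mirror image under `ρ ↦ 1/ρ`. -/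
theorem left_weight_ratio_mem_Icc {N : ℕ} (hN : 0 < N) {ρ : ℝ} (hρ : ρ ∈ Set.Icc (N : ℝ)⁻¹ N) :
    ((N : ℝ) + 1) * ρ / (1 + ρ) ∈ Set.Icc (N : ℝ)⁻¹ N := by
  have hN' : (1 : ℝ) ≤ N := Nat.one_le_cast.mpr hN
  have h0 : 0 < ρ := lt_of_lt_of_le (by positivity) hρ.1
  have h1 : 1 ≤ N * ρ := by
    have := mul_le_mul_of_nonneg_left hρ.1 (by positivity : (0 : ℝ) ≤ N)
    rwa [mul_inv_cancel₀ (by positivity)] at this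
  have h2 := hρ.2
  constructor
  · rw [le_div_iff₀ (by positivity), inv_mul_le_iff₀ (by positivity)]
    nlinarith
  · rw [div_le_iff₀ (by positivity)]
    nlinarith

theorem right_weight_ratio_mem_Icc {N : ℕ} (hN : 0 < N) {ρ : ℝ} (hρ : ρ ∈ Set.Icc (N : ℝ)⁻¹ N) :
    (1 + ρ) / ((N : ℝ) + 1) ∈ Set.Icc (N : ℝ)⁻¹ N := by
  have hN' : (1 : ℝ) ≤ N := Nat.one_le_cast.mpr hN
  have h0 : 0 < ρ := lt_of_lt_of_le (by positivity) hρ.1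
  have h1 : 1 ≤ N * ρ := by
    have := mul_le_mul_of_nonneg_left hρ.1 (by positivity : (0 : ℝ) ≤ N)
    rwa [mul_inv_cancel₀ (by positivity)] at this
  have h2 := hρ.2
  constructor
  · rw [le_div_iff₀ (by positivity), inv_mul_le_iff₀ (by positivity)]
    nlinarith
  · rw [div_le_iff₀ (by positivity)]
    nlinarith

/-- The contraction rate of `fluxPosition` when an edge is halved. -/
theorem halving_rates {N : ℕ} (hN : 0 < N) {ρ : ℝ} (hρ : ρ ∈ Set.Icc (N : ℝ)⁻¹ N) :
    0 ≤ 1 / (1 + ρ) ∧ 1 / (1 + ρ) ≤ (N : ℝ) / (N + 1) ∧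
      0 ≤ ρ / (1 + ρ) ∧ ρ / (1 + ρ) ≤ (N : ℝ) / (N + 1) := by
  have hN' : (1 : ℝ) ≤ N := Nat.one_le_cast.mpr hN
  have h0 : 0 < ρ := lt_of_lt_of_le (by positivity) hρ.1
  have h1 : 1 ≤ N * ρ := by
    have := mul_le_mul_of_nonneg_left hρ.1 (by positivity : (0 : ℝ) ≤ N)
    rwa [mul_inv_cancel₀ (by positivity)] at this
  have h2 := hρ.2
  refine ⟨by positivity, ?_, by positivity, ?_⟩ <;>
  · rw [div_le_div_iff₀ (by positivity) (by positivity)]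
    nlinarith

theorem fluxPosition_mem_Icc {N : ℕ} (hN : 0 < N) {ρ : ℝ} (hρ : ρ ∈ Set.Icc (N : ℝ)⁻¹ N)
    (τ : List Bool) (e : Bool) : fluxPosition N ρ τ e ∈ Set.Icc (0 : ℝ) 1 := by
  induction τ generalizing ρ with
  | nil => cases e <;> simp [fluxPosition]
  | cons b τ ih =>
    obtain ⟨h1, h2, h3, h4⟩ := halving_rates hN hρ
    have h5 : (N : ℝ) / (N + 1) ≤ 1 := div_le_one_of_le₀ (by linarith) (by positivity)
    cases b
    · obtain ⟨h6, h7⟩ := ih (left_weight_ratio_mem_Icc hN hρ)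
      simp only [fluxPosition, Bool.false_eq_true, if_false, Set.mem_Icc]
      exact ⟨mul_nonneg h1 h6, mul_le_one₀ (h2.trans h5) h6 h7⟩
    · obtain ⟨h6, h7⟩ := ih (right_weight_ratio_mem_Icc hN hρ)
      simp only [fluxPosition, if_true, Set.mem_Icc]
      have h8 := mul_le_one₀ (h4.trans h5) (sub_nonneg.mpr h7) (by linarith)
      have h9 := mul_nonneg h3 (sub_nonneg.mpr h7)
      exact ⟨by linarith, by linarith⟩

/-! ### Hölder continuity of the position. -/

section Holder

variable {N : ℕ} {α : ℝ}

theorem half_rpow_eq (hN : 0 < N) (hα : α = Real.logb 2 (1 + 1 / (N : ℝ))) :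
    (2⁻¹ : ℝ) ^ α = (N : ℝ) / (N + 1) := by
  have hN' : (0 : ℝ) < N := Nat.cast_pos.mpr hN
  rw [hα, Real.inv_rpow zero_le_two, Real.rpow_logb two_pos (by norm_num) (by positivity)]
  field_simp

theorem div_two_rpow (hN : 0 < N) (hα : α = Real.logb 2 (1 + 1 / (N : ℝ))) {x : ℝ} (hx : 0 ≤ x) :
    (x / 2) ^ α = (N : ℝ) / (N + 1) * x ^ α := by
  rw [div_eq_mul_inv, Real.mul_rpow hx (by norm_num), half_rpow_eq hN hα, mul_comm]

theorem exponent_pos (hN : 0 < N) (hα : α = Real.logb 2 (1 + 1 / (N : ℝ))) : 0 < α := by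
  have hN' : (0 : ℝ) < N := Nat.cast_pos.mpr hN
  rw [hα]
  exact Real.logb_pos one_lt_two (lt_add_of_pos_right 1 (by positivity))

theorem one_le_mul_rpow (hN : 0 < N) (hα : α = Real.logb 2 (1 + 1 / (N : ℝ))) {x : ℝ}
    (hx : 1 / 2 ≤ x) : 1 ≤ ((N : ℝ) + 1) / N * x ^ α := by
  have hN' : (0 : ℝ) < N := Nat.cast_pos.mpr hN
  have h1 : (2⁻¹ : ℝ) ^ α ≤ x ^ α :=
    Real.rpow_le_rpow (by norm_num) (by linarith) (exponent_pos hN hα).le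
  rw [half_rpow_eq hN hα] at h1
  calc (1 : ℝ) = ((N : ℝ) + 1) / N * (N / (N + 1)) := by field_simp
    _ ≤ _ := mul_le_mul_of_nonneg_left h1 (by positivity)

/-- Passing to the left half costs at most `N/(N+1)` on the left and exactly that on the right. On
the right half the parameter is at least `1/2`, and the constant makes the bound at least `1`. -/
theorem fluxPosition_le (hN : 0 < N) (hα : α = Real.logb 2 (1 + 1 / (N : ℝ))) {ρ : ℝ}
    (hρ : ρ ∈ Set.Icc (N : ℝ)⁻¹ N) (τ : List Bool) (e : Bool) :
    fluxPosition N ρ τ e ≤ ((N : ℝ) + 1) / N * dyadicPoint τ e ^ α := by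
  induction τ generalizing ρ with
  | nil =>
    cases e
    · simp [fluxPosition, dyadicPoint, Real.zero_rpow (exponent_pos hN hα).ne']
    · exact (fluxPosition_mem_Icc hN hρ [] true).2.trans
        (one_le_mul_rpow hN hα (by norm_num [dyadicPoint]))
  | cons b τ ih =>
    have hd := dyadicPoint_mem_Icc τ e
    cases b
    · have h1 := ih (left_weight_ratio_mem_Icc hN hρ)
      have h2 := (fluxPosition_mem_Icc hN (left_weight_ratio_mem_Icc hN hρ) τ e).1
      obtain ⟨h3, h4, -, -⟩ := halving_rates hN hρ
      simp only [fluxPosition, dyadicPoint, Bool.false_eq_true, if_false]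
      rw [div_two_rpow hN hα hd.1, mul_left_comm]
      exact mul_le_mul h4 h1 h2 (by positivity)
    · refine (fluxPosition_mem_Icc hN hρ (true :: τ) e).2.trans (one_le_mul_rpow hN hα ?_)
      simp only [dyadicPoint, if_true]
      linarith [hd.1]

theorem one_sub_fluxPosition_le (hN : 0 < N) (hα : α = Real.logb 2 (1 + 1 / (N : ℝ))) {ρ : ℝ}
    (hρ : ρ ∈ Set.Icc (N : ℝ)⁻¹ N) (τ : List Bool) (e : Bool) :
    1 - fluxPosition N ρ τ e ≤ ((N : ℝ) + 1) / N * (1 - dyadicPoint τ e) ^ α := by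
  induction τ generalizing ρ with
  | nil =>
    cases e
    · refine le_trans ?_ (one_le_mul_rpow hN hα (by norm_num [dyadicPoint]))
      linarith [(fluxPosition_mem_Icc hN hρ [] false).1]
    · simp [fluxPosition, dyadicPoint, Real.zero_rpow (exponent_pos hN hα).ne']
  | cons b τ ih =>
    have hd := dyadicPoint_mem_Icc τ e
    cases b
    · refine le_trans ?_ (one_le_mul_rpow hN hα (x := 1 - dyadicPoint (false :: τ) e) ?_)
      · linarith [(fluxPosition_mem_Icc hN hρ (false :: τ) e).1]
      · simp only [dyadicPoint, Bool.false_eq_true, if_false]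
        linarith [hd.2]
    · have h1 := ih (right_weight_ratio_mem_Icc hN hρ)
      have h2 := (fluxPosition_mem_Icc hN (right_weight_ratio_mem_Icc hN hρ) τ e).2
      obtain ⟨-, -, h3, h4⟩ := halving_rates hN hρ
      simp only [fluxPosition, dyadicPoint, if_true]
      rw [show 1 - (1 + dyadicPoint τ e) / 2 = (1 - dyadicPoint τ e) / 2 by ring,
        div_two_rpow hN hα (by linarith [hd.2]), mul_left_comm, sub_sub_cancel]
      exact mul_le_mul h4 h1 (by linarith) (by positivity)

/-- Go through the midpoint: each piece obeys a one-sided estimate at an end of its half, hence the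
factor `2`. -/
theorem abs_fluxPosition_sub_le_of_ne (hN : 0 < N) (hα : α = Real.logb 2 (1 + 1 / (N : ℝ))) {ρ : ℝ}
    (hρ : ρ ∈ Set.Icc (N : ℝ)⁻¹ N) (σ τ : List Bool) (d e : Bool) :
    |fluxPosition N ρ (false :: σ) d - fluxPosition N ρ (true :: τ) e| ≤
      2 * (((N : ℝ) + 1) / N) *
        |dyadicPoint (false :: σ) d - dyadicPoint (true :: τ) e| ^ α := by
  have hN' : (0 : ℝ) < N := Nat.cast_pos.mpr hN
  obtain ⟨h1, h2, h3, h4⟩ := halving_rates hN hρ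
  have h5 := one_sub_fluxPosition_le hN hα (left_weight_ratio_mem_Icc hN hρ) σ d
  have h6 := fluxPosition_le hN hα (right_weight_ratio_mem_Icc hN hρ) τ e
  have h7 := (fluxPosition_mem_Icc hN (left_weight_ratio_mem_Icc hN hρ) σ d).2
  have h8 := (fluxPosition_mem_Icc hN (right_weight_ratio_mem_Icc hN hρ) τ e).1
  have hd := dyadicPoint_mem_Icc σ d
  have he := dyadicPoint_mem_Icc τ e
  have h0 : 0 < ρ := lt_of_lt_of_le (by positivity) hρ.1
  simp only [fluxPosition, dyadicPoint, Bool.false_eq_true, if_false, if_true]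
  generalize fluxPosition N (((N : ℝ) + 1) * ρ / (1 + ρ)) σ d = s at *
  generalize fluxPosition N ((1 + ρ) / ((N : ℝ) + 1)) τ e = t at *
  generalize dyadicPoint σ d = a at *
  generalize dyadicPoint τ e = b at *
  have h9 : 1 / (1 + ρ) * s - (1 - ρ / (1 + ρ) * (1 - t)) =
      -(1 / (1 + ρ) * (1 - s) + ρ / (1 + ρ) * t) := by field_simp; ring
  have h10 : a / 2 - (1 + b) / 2 = -(((1 - a) + b) / 2) := by ring
  rw [h9, h10, abs_neg, abs_neg,
    abs_of_nonneg (add_nonneg (mul_nonneg h1 (by linarith)) (mul_nonneg h3 h8)),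
    abs_of_nonneg (by linarith [hd.2, he.1]), div_two_rpow hN hα (by linarith [hd.2, he.1])]
  have h11 : (1 - a) ^ α ≤ ((1 - a) + b) ^ α :=
    Real.rpow_le_rpow (by linarith [hd.2]) (by linarith [he.1]) (exponent_pos hN hα).le
  have h12 : b ^ α ≤ ((1 - a) + b) ^ α :=
    Real.rpow_le_rpow he.1 (by linarith [hd.2]) (exponent_pos hN hα).le
  generalize ((1 - a) + b) ^ α = X at *
  -- The contraction rate of a half cancels the constant of the one-sided estimate.
  have h13 : ∀ {x y z : ℝ}, 0 ≤ x → x ≤ (N : ℝ) / (N + 1) → 0 ≤ y →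
      y ≤ ((N : ℝ) + 1) / N * z → z ≤ X → x * y ≤ X := by
    intro x y z hx1 hx2 hy1 hy2 hz
    calc x * y ≤ (N : ℝ) / (N + 1) * (((N : ℝ) + 1) / N * z) :=
          mul_le_mul hx2 hy2 hy1 (by positivity)
      _ = z := by field_simp
      _ ≤ X := hz
  have h14 := h13 h1 h2 (sub_nonneg.mpr h7) h5 h11
  have h15 := h13 h3 h4 h8 h6 h12
  have h16 : 2 * (((N : ℝ) + 1) / N) * ((N : ℝ) / (N + 1) * X) = X + X := by field_simp; ring
  rw [h16]
  exact add_le_add h14 h15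

theorem abs_fluxPosition_nil_sub_le (hN : 0 < N) (hα : α = Real.logb 2 (1 + 1 / (N : ℝ))) {ρ : ℝ}
    (hρ : ρ ∈ Set.Icc (N : ℝ)⁻¹ N) (τ : List Bool) (d e : Bool) :
    |fluxPosition N ρ [] d - fluxPosition N ρ τ e| ≤
      2 * (((N : ℝ) + 1) / N) * |dyadicPoint [] d - dyadicPoint τ e| ^ α := by
  have hdbl : ∀ {x z : ℝ}, 0 ≤ z → x ≤ ((N : ℝ) + 1) / N * z ^ α →
      x ≤ 2 * (((N : ℝ) + 1) / N) * z ^ α := by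
    intro x z hz hx
    have : 0 ≤ ((N : ℝ) + 1) / N * z ^ α := by positivity
    linarith
  have h1 := dyadicPoint_mem_Icc τ e
  have h2 := fluxPosition_mem_Icc hN hρ τ e
  cases d
  · have h3 := fluxPosition_le hN hα hρ τ e
    simp only [fluxPosition, dyadicPoint, Bool.false_eq_true, if_false, zero_sub, abs_neg]
    rw [abs_of_nonneg h1.1, abs_of_nonneg h2.1]
    exact hdbl h1.1 h3
  · have h3 := one_sub_fluxPosition_le hN hα hρ τ e
    simp only [fluxPosition, dyadicPoint, if_true]
    rw [abs_of_nonneg (sub_nonneg.mpr h1.2), abs_of_nonneg (sub_nonneg.mpr h2.2)]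
    exact hdbl (sub_nonneg.mpr h1.2) h3

/-- While both points lie in the same half, rescaling preserves the estimate with the same constant,
because the contraction is at most `2^(-α)`. -/
theorem abs_fluxPosition_sub_le (hN : 0 < N) (hα : α = Real.logb 2 (1 + 1 / (N : ℝ))) {ρ : ℝ}
    (hρ : ρ ∈ Set.Icc (N : ℝ)⁻¹ N) (σ τ : List Bool) (d e : Bool) :
    |fluxPosition N ρ σ d - fluxPosition N ρ τ e| ≤
      2 * (((N : ℝ) + 1) / N) * |dyadicPoint σ d - dyadicPoint τ e| ^ α := by
  induction σ generalizing ρ τ with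
  | nil => exact abs_fluxPosition_nil_sub_le hN hα hρ τ d e
  | cons b σ ih =>
    cases τ with
    | nil =>
      rw [abs_sub_comm, abs_sub_comm (dyadicPoint _ _)]
      exact abs_fluxPosition_nil_sub_le hN hα hρ (b :: σ) e d
    | cons b' τ =>
      obtain ⟨h1, h2, h3, h4⟩ := halving_rates hN hρ
      cases b <;> cases b'
      · simp only [fluxPosition, dyadicPoint, Bool.false_eq_true, if_false]
        rw [← mul_sub, ← sub_div, abs_mul, abs_of_nonneg h1, abs_div, abs_two,
          div_two_rpow hN hα (abs_nonneg _), mul_left_comm]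
        exact mul_le_mul h2 (ih (left_weight_ratio_mem_Icc hN hρ) τ) (abs_nonneg _) (by positivity)
      · exact abs_fluxPosition_sub_le_of_ne hN hα hρ σ τ d e
      · rw [abs_sub_comm, abs_sub_comm (dyadicPoint _ _)]
        exact abs_fluxPosition_sub_le_of_ne hN hα hρ τ σ e d
      · simp only [fluxPosition, dyadicPoint, if_true]
        rw [sub_sub_sub_cancel_left, ← mul_sub, sub_sub_sub_cancel_left, ← sub_div,
          add_sub_add_left_eq_sub, abs_mul, abs_of_nonneg h3, abs_div, abs_two,
          div_two_rpow hN hα (abs_nonneg _), mul_left_comm]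
        exact mul_le_mul h4 (ih (right_weight_ratio_mem_Icc hN hρ) τ) (abs_nonneg _) (by positivity)

end Holder

/-! ### Fluxes and densities on an edge. -/

/-- The normal derivative at a dyadic point of an edge is, up to sign and scale, the combination
`α d_i - β d_j` of the normal derivatives at the ends; these are the coefficients `(α, β)`. -/
def fluxWeights (N : ℕ) : List Bool → Bool → ℝ × ℝ
  | [], e => if e then (0, 1) else (1, 0)
  | b :: τ, e =>
    if b then ((fluxWeights N τ e).1 / ((N : ℝ) + 1),
      (fluxWeights N τ e).2 + (fluxWeights N τ e).1 / ((N : ℝ) + 1))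
    else ((fluxWeights N τ e).1 + (fluxWeights N τ e).2 / ((N : ℝ) + 1),
      (fluxWeights N τ e).2 / ((N : ℝ) + 1))

theorem fluxWeights_nonneg (N : ℕ) (τ : List Bool) (e : Bool) :
    0 ≤ (fluxWeights N τ e).1 ∧ 0 ≤ (fluxWeights N τ e).2 ∧
      0 < (fluxWeights N τ e).1 + (fluxWeights N τ e).2 := by
  induction τ with
  | nil => cases e <;> simp [fluxWeights]
  | cons b τ ih =>
    obtain ⟨h1, h2, h3⟩ := ih
    have h4 : 0 ≤ (fluxWeights N τ e).1 / ((N : ℝ) + 1) := by positivity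
    have h5 : 0 ≤ (fluxWeights N τ e).2 / ((N : ℝ) + 1) := by positivity
    have h6 : (0 : ℝ) < (N : ℝ) + 1 := by positivity
    rcases h1.eq_or_lt with h | h
    · have h7 : 0 < (fluxWeights N τ e).2 / ((N : ℝ) + 1) := div_pos (by linarith) h6
      cases b <;> simp only [fluxWeights, Bool.false_eq_true, if_false, if_true] <;>
        exact ⟨by linarith, by linarith, by linarith⟩
    · have h7 : 0 < (fluxWeights N τ e).1 / ((N : ℝ) + 1) := div_pos h h6
      cases b <;> simp only [fluxWeights, Bool.false_eq_true, if_false, if_true] <;>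
        exact ⟨by linarith, by linarith, by linarith⟩

/-- The recursion for the position is that for the weights, read in the affine chart where the two
end functionals have weights `ρ` and `1`. -/
theorem fluxPosition_eq (N : ℕ) {ρ : ℝ} (hρ : 0 < ρ) (τ : List Bool) (e : Bool) :
    fluxPosition N ρ τ e = (fluxWeights N τ e).2 /
      (ρ * (fluxWeights N τ e).1 + (fluxWeights N τ e).2) := by
  induction τ generalizing ρ with
  | nil => cases e <;> simp [fluxPosition, fluxWeights]
  | cons b τ ih =>
    obtain ⟨h1, h2, h3⟩ := fluxWeights_nonneg N τ e
    have h4 : ∀ {s t : ℝ}, 0 < s → 0 < t →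
        0 < s * (fluxWeights N τ e).1 + t * (fluxWeights N τ e).2 := by
      intro s t hs ht
      rcases h1.eq_or_lt with h | h
      · rw [← h] at h3 ⊢
        have : 0 < t * (fluxWeights N τ e).2 := mul_pos ht (by linarith)
        linarith
      · have h6 := mul_pos hs h
        have h7 := mul_nonneg ht.le h2
        linarith
    have hN : (0 : ℝ) < (N : ℝ) + 1 := by positivity
    cases b
    · simp only [fluxPosition, fluxWeights, Bool.false_eq_true, if_false]
      rw [ih (by positivity)]
      have h5 := h4 (mul_pos hN hρ) (by positivity : 0 < 1 + ρ)
      have h6 : ((N : ℝ) + 1) * ρ / (1 + ρ) * (fluxWeights N τ e).1 + (fluxWeights N τ e).2 ≠ 0 := by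
        have : ((N : ℝ) + 1) * ρ / (1 + ρ) * (fluxWeights N τ e).1 + (fluxWeights N τ e).2 =
          (((N : ℝ) + 1) * ρ * (fluxWeights N τ e).1 + (1 + ρ) * (fluxWeights N τ e).2) / (1 + ρ) := by
          field_simp
        rw [this]; positivity
      have h7 : ρ * ((fluxWeights N τ e).1 + (fluxWeights N τ e).2 / ((N : ℝ) + 1)) +
          (fluxWeights N τ e).2 / ((N : ℝ) + 1) ≠ 0 := by
        have : ρ * ((fluxWeights N τ e).1 + (fluxWeights N τ e).2 / ((N : ℝ) + 1)) +
          (fluxWeights N τ e).2 / ((N : ℝ) + 1) =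
          (((N : ℝ) + 1) * ρ * (fluxWeights N τ e).1 + (1 + ρ) * (fluxWeights N τ e).2) /
            ((N : ℝ) + 1) := by
          field_simp; ring
        rw [this]; positivity
      rw [div_mul_div_comm, one_mul, div_eq_div_iff (by positivity) h7]
      field_simp
      ring
    · simp only [fluxPosition, fluxWeights, if_true]
      rw [ih (by positivity)]
      have h5 := h4 (by positivity : 0 < 1 + ρ) hN
      have h6 : (1 + ρ) / ((N : ℝ) + 1) * (fluxWeights N τ e).1 + (fluxWeights N τ e).2 =
          ((1 + ρ) * (fluxWeights N τ e).1 + ((N : ℝ) + 1) * (fluxWeights N τ e).2) /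
            ((N : ℝ) + 1) := by field_simp
      have h7 : ρ * ((fluxWeights N τ e).1 / ((N : ℝ) + 1)) +
          ((fluxWeights N τ e).2 + (fluxWeights N τ e).1 / ((N : ℝ) + 1)) =
          ((1 + ρ) * (fluxWeights N τ e).1 + ((N : ℝ) + 1) * (fluxWeights N τ e).2) /
            ((N : ℝ) + 1) := by field_simp; ring
      rw [h6, h7]
      generalize hX : (1 + ρ) * (fluxWeights N τ e).1 + ((N : ℝ) + 1) * (fluxWeights N τ e).2 = X
        at *
      have hX' : (fluxWeights N τ e).2 =
          (X - (1 + ρ) * (fluxWeights N τ e).1) / ((N : ℝ) + 1) := by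
        rw [← hX]; field_simp; ring
      rw [hX']
      field_simp
      ring

/-- Halving acts on the two end fluxes alone, since `u i - u j` is their difference divided by `N +
1`; the other values of `u` do not enter. -/
theorem flux_restrict_edge {N : ℕ} {i j : Fin (N + 1)} (hij : i ≠ j) (τ : List Bool) (e : Bool)
    (v : Fin (N + 1) → ℝ) :
    flux (bif e then j else i) (restrict (τ.map fun b => bif b then j else i) v) =
      (bif e then -1 else 1) * ratio N ^ τ.length *
        ((fluxWeights N τ e).1 * flux i v - (fluxWeights N τ e).2 * flux j v) := by
  induction τ generalizing v with
  | nil => cases e <;> simp [fluxWeights, restrict]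
  | cons b τ ih =>
    have hd : v i - v j = (flux j v - flux i v) / ((N : ℝ) + 1) := by
      simp only [flux]; field_simp; ring
    have hd' : v j - v i = (flux i v - flux j v) / ((N : ℝ) + 1) := by
      simp only [flux]; field_simp; ring
    rw [List.map_cons, restrict, ih, List.length_cons, pow_succ]
    cases b
    · simp only [fluxWeights, cond_false, Bool.false_eq_true, if_false]
      rw [flux_step_self, flux_step_of_ne hij.symm, hd]
      ring
    · simp only [fluxWeights, cond_true, if_true]
      rw [flux_step_self, flux_step_of_ne hij, hd']
      ring

/-- The density along an edge as a rational function of `fluxPosition`. -/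
def edgeDensity {N : ℕ} (u : Fin (N + 1) → ℝ) (w : List (Fin (N + 1))) (i j : Fin (N + 1))
    (t : ℝ) : ℝ :=
  ((1 - t) * flux i (restrict w u) - t * flux j (restrict w u)) ^ 2 /
    ∑ k, ((1 - t) * flux i (restrict w (Pi.single k 1)) -
      t * flux j (restrict w (Pi.single k 1))) ^ 2

/-- The scale factor of the flux depends only on the address, not on the harmonic function, so it
cancels in the quotient. -/
theorem vertexDensity_edge {N : ℕ} (u : Fin (N + 1) → ℝ) (w : List (Fin (N + 1)))
    {i j : Fin (N + 1)} (hij : i ≠ j) (τ : List Bool) (e : Bool) :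
    vertexDensity u (w ++ τ.map fun b => bif b then j else i) (bif e then j else i) =
      edgeDensity u w i j (fluxPosition N 1 τ e) := by
  obtain ⟨-, -, h3⟩ := fluxWeights_nonneg N τ e
  have h4 : ∀ v, flux (bif e then j else i)
      (restrict (w ++ τ.map fun b => bif b then j else i) v) =
      ((bif e then -1 else 1) * ratio N ^ τ.length *
        ((fluxWeights N τ e).1 + (fluxWeights N τ e).2)) *
        ((1 - fluxPosition N 1 τ e) * flux i (restrict w v) -
          fluxPosition N 1 τ e * flux j (restrict w v)) := by
    intro v
    rw [restrict_append, flux_restrict_edge hij, fluxPosition_eq N one_pos, one_mul]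
    field_simp
    ring
  have h5 : (bif e then -1 else 1) * ratio N ^ τ.length *
        ((fluxWeights N τ e).1 + (fluxWeights N τ e).2) ≠ 0 := by
    have := ratio_pos N
    cases e <;> simp [this.ne', h3.ne']
  simp only [vertexDensity, h4, mul_pow _ _ 2, ← Finset.mul_sum, edgeDensity]
  rw [← mul_pow, ← mul_pow]
  exact mul_div_mul_left _ _ (pow_ne_zero 2 h5)

theorem exists_lipschitzOnWith_edgeDensity {N : ℕ} (u : Fin (N + 1) → ℝ)
    (w : List (Fin (N + 1))) {i j : Fin (N + 1)} (hij : i ≠ j) :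
    ∃ L, LipschitzOnWith L (edgeDensity u w i j) (Set.Icc 0 1) := by
  have h1 : ∀ t : ℝ, ∑ k, ((1 - t) * flux i (restrict w (Pi.single k 1)) -
      t * flux j (restrict w (Pi.single k 1))) ^ 2 ≠ 0 := by
    intro t
    -- On `e_i - e_j` the interpolated functional equals `-(N+1)` for every `t`, so it is never
    -- zero.
    refine (sum_sq_restrict_pos w ((1 - t) • fluxLinear i - t • fluxLinear j)
      (v := Pi.single i 1 - Pi.single j 1) ?_).ne'
    have h2 : ((N : ℝ) + 1) ≠ 0 := by positivity
    have h3 : (1 - t) * -((N : ℝ) + 1) - t * (-(((N : ℝ) + 1) * -1)) ≠ 0 := by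
      intro h
      apply h2
      linarith
    simpa [fluxLinear, flux, hij, hij.symm] using h3
  have h2 : ContDiff ℝ 1 (edgeDensity u w i j) := by
    unfold edgeDensity
    refine ContDiff.div (by fun_prop) ?_ h1
    fun_prop
  exact h2.locallyLipschitz.locallyLipschitzOn.exists_lipschitzOnWith_of_compact isCompact_Icc

/-! ### Dyadic addresses on an edge. -/

theorem wordMap_dyadic {N : ℕ} (p : Fin (N + 1) → EuclideanSpace ℝ (Fin N))
    (i j : Fin (N + 1)) (τ : List Bool) (e : Bool) :
    wordMap p (τ.map fun b => bif b then j else i) (p (bif e then j else i)) =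
      p i + dyadicPoint τ e • (p j - p i) := by
  induction τ with
  | nil => cases e <;> simp [wordMap, dyadicPoint]
  | cons b τ ih =>
    rw [List.map_cons, wordMap, Function.comp_apply, ih, contraction]
    cases b
    · simp only [cond_false, dyadicPoint, Bool.false_eq_true, if_false]
      module
    · simp only [cond_true, dyadicPoint, if_true]
      module

theorem wordMap_sub {N : ℕ} (p : Fin (N + 1) → EuclideanSpace ℝ (Fin N))
    (w : List (Fin (N + 1))) (x y : EuclideanSpace ℝ (Fin N)) :
    wordMap p w x - wordMap p w y = (2⁻¹ : ℝ) ^ w.length • (x - y) := by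
  induction w with
  | nil => simp [wordMap]
  | cons i w ih =>
    rw [List.length_cons, pow_succ', mul_smul, ← ih]
    simp only [wordMap, Function.comp_apply, contraction]
    module

theorem dist_edge {N : ℕ} (p : Fin (N + 1) → EuclideanSpace ℝ (Fin N))
    (w : List (Fin (N + 1))) (i j : Fin (N + 1)) (σ τ : List Bool) (d e : Bool) :
    dist (cellMap p (w ++ σ.map fun b => bif b then j else i) (vertex p (bif d then j else i)))
      (cellMap p (w ++ τ.map fun b => bif b then j else i) (vertex p (bif e then j else i))) =
      2⁻¹ ^ w.length * ‖p j - p i‖ * |dyadicPoint σ d - dyadicPoint τ e| := by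
  rw [cellMap_append, cellMap_append, Subtype.dist_eq, dist_eq_norm]
  change ‖wordMap p w (wordMap p (σ.map fun b => bif b then j else i) (p (bif d then j else i))) -
    wordMap p w (wordMap p (τ.map fun b => bif b then j else i) (p (bif e then j else i)))‖ = _
  rw [wordMap_sub, wordMap_dyadic, wordMap_dyadic, add_sub_add_left_eq_sub, ← sub_smul,
    norm_smul, norm_smul, Real.norm_eq_abs, Real.norm_eq_abs, abs_of_pos (by positivity)]
  ring

/-- Coordinates are nonnegative, so a letter `l` other than `i` and `j` would make the `l`-th
coordinate positive. -/
theorem exists_dyadic_of_coord_eq_zero {N : ℕ} {p : Fin (N + 1) → EuclideanSpace ℝ (Fin N)}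
    (hp : AffineIndependent ℝ p) {i j : Fin (N + 1)} {w : List (Fin (N + 1))} {k : Fin (N + 1)}
    (hz : ∀ l, l ≠ i → l ≠ j → (vertexBasis hp).coord l (cellMap p w (vertex p k)) = 0) :
    ∃ (τ : List Bool) (e : Bool), w = (τ.map fun b => bif b then j else i) ∧
      k = bif e then j else i := by
  have letter : ∀ l, l = i ∨ l = j → ∃ b : Bool, l = bif b then j else i := by
    rintro l (rfl | rfl)
    · exact ⟨false, rfl⟩
    · exact ⟨true, rfl⟩
  induction w with
  | nil =>
    obtain ⟨e, he⟩ := letter k <| by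
      by_contra! hcon
      have h1 := hz k hcon.1 hcon.2
      have h2 : (vertexBasis hp).coord k (cellMap p [] (vertex p k)) = if k = k then 1 else 0 :=
        coord_vertex hp k k
      rw [h2, if_pos rfl] at h1
      exact one_ne_zero h1
    exact ⟨[], e, rfl, he⟩
  | cons a w ih =>
    have h1 : ∀ l, (vertexBasis hp).coord l (cellMap p (a :: w) (vertex p k)) =
        2⁻¹ * ((vertexBasis hp).coord l (cellMap p w (vertex p k)) + if l = a then 1 else 0) :=
      fun l => coord_contraction hp a l _
    have h2 : ∀ l, 0 ≤ (vertexBasis hp).coord l (cellMap p w (vertex p k)) := fun l =>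
      coord_nonneg hp l (gasket_subset_hull (cellMap p w (vertex p k)).2)
    obtain ⟨b, hb⟩ := letter a <| by
      by_contra! hcon
      have h3 := hz a hcon.1 hcon.2
      rw [h1, if_pos rfl] at h3
      linarith [h2 a]
    obtain ⟨τ, e, hτ, he⟩ := ih fun l hli hlj => by
      have h3 := hz l hli hlj
      rw [h1] at h3
      have h4 := h2 l
      split_ifs at h3 <;> linarith
    exact ⟨b :: τ, e, by rw [List.map_cons, ← hτ, ← hb], he⟩

/-- Strip letters from both sides. If the first letters differ, the image of `z` under the remaining
word is a vertex, and the induction goes on with the empty word as its address. -/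
theorem exists_address_of_wordMap_eq {N : ℕ} {p : Fin (N + 1) → EuclideanSpace ℝ (Fin N)}
    (hp : AffineIndependent ℝ p) {w w' : List (Fin (N + 1))} {k : Fin (N + 1)}
    {z : EuclideanSpace ℝ (Fin N)} (hz : z ∈ convexHull ℝ (Set.range p))
    (h : wordMap p w' (p k) = wordMap p w z) :
    ∃ (v : List (Fin (N + 1))) (l : Fin (N + 1)), z = wordMap p v (p l) := by
  have hmem : ∀ (v : List (Fin (N + 1))) {y}, y ∈ convexHull ℝ (Set.range p) →
      wordMap p v y ∈ convexHull ℝ (Set.range p) := by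
    intro v y hy
    induction v with
    | nil => exact hy
    | cons a v ih => exact contraction_mem_hull a ih
  have hvert : ∀ l, p l ∈ convexHull ℝ (Set.range p) := fun l =>
    subset_convexHull ℝ _ (Set.mem_range_self l)
  induction w generalizing w' k with
  | nil => exact ⟨w', k, h.symm⟩
  | cons a w ih =>
    cases w' with
    | nil =>
      exact ih (w' := []) (contraction_eq_vertex hp (hmem w hz) h.symm).2.symm
    | cons a' w' =>
      by_cases ha : a' = a
      · subst ha
        exact ih (contraction_injective p _ h)
      · exact ih (w' := []) (contraction_eq_contraction hp (Ne.symm ha) (hmem w hz)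
          (hmem w' (hvert k)) h.symm).symm

theorem exists_dyadic_of_mem_edge {N : ℕ} {p : Fin (N + 1) → EuclideanSpace ℝ (Fin N)}
    (hp : AffineIndependent ℝ p) {w : List (Fin (N + 1))} {i j : Fin (N + 1)} {x : vertexSet p}
    (hx : x ∈ edge p w i j) : ∃ (τ : List Bool) (e : Bool), (x : gasket p) =
      cellMap p (w ++ τ.map fun b => bif b then j else i) (vertex p (bif e then j else i)) := by
  obtain ⟨z, hz, hzx⟩ := hx
  obtain ⟨w', k, hxk⟩ := x.2
  have hhull : z ∈ convexHull ℝ (Set.range p) :=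
    (convex_convexHull ℝ (Set.range p)).segment_subset
      (subset_convexHull ℝ _ (Set.mem_range_self i))
      (subset_convexHull ℝ _ (Set.mem_range_self j)) hz
  obtain ⟨v, l, rfl⟩ := exists_address_of_wordMap_eq hp hhull
    ((congrArg Subtype.val hxk).symm.trans hzx.symm)
  obtain ⟨τ, e, rfl, rfl⟩ := exists_dyadic_of_coord_eq_zero hp (i := i) (j := j) (w := v) (k := l)
    fun a hai haj => by
      rw [segment_eq_image_lineMap] at hz
      obtain ⟨s, -, hs⟩ := hz
      change (vertexBasis hp).coord a (wordMap p v (p l)) = 0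
      rw [← hs, AffineMap.apply_lineMap, coord_vertex, coord_vertex, if_neg hai, if_neg haj]
      simp
  refine ⟨τ, e, ?_⟩
  rw [cellMap_append]
  exact Subtype.ext hzx.symm

end

end Gasket


/-! ### Proof of the theorem. -/

theorem theorem2p3 (N : ℕ) (hN : 2 ≤ N) (p : Fin (N + 1) → EuclideanSpace ℝ (Fin N))
    (hp : AffineIndependent ℝ p) (h : C(Gasket.gasket p, ℝ)) (hh : Gasket.IsHarmonic p h) :
    (∀ w : List (Fin (N + 1)), 0 < (Gasket.kusuokaMeasure p).real (Gasket.cell p w)) ∧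
    (∃! δ : Gasket.vertexSet p → ℝ, Gasket.IsPointwiseDensity p h δ) ∧
    ∀ δ : Gasket.vertexSet p → ℝ, Gasket.IsPointwiseDensity p h δ →
      ∀ (w : List (Fin (N + 1))) (i j : Fin (N + 1)), i ≠ j →
        ∃ C : ℝ≥0, HolderOnWith C (Real.logb 2 (1 + 1 / (N : ℝ))).toNNReal δ
          (Gasket.edge p w i j) := by
  open Gasket in
  have hN0 : 0 < N := by omega
  obtain ⟨u, hu⟩ := hh
  have hv := hu.hasHarmonicValues hp
  refine ⟨fun w => ?_, ?_, fun δ hδ w i j hij => ?_⟩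
  · rw [kusuokaMeasure_real_cell hp]
    exact sum_cellMass_single_pos hN0 w
  · obtain ⟨δ, hδ⟩ := exists_isPointwiseDensity hN0 hp hv
    refine ⟨δ, hδ, fun δ' hδ' => funext fun x => ?_⟩
    obtain ⟨w, j, hx⟩ := x.2
    rw [hδ.eq_vertexDensity hN0 hp hv hx, hδ'.eq_vertexDensity hN0 hp hv hx]
  · set α := Real.logb 2 (1 + 1 / (N : ℝ)) with hα
    have hα0 : 0 < α := exponent_pos hN0 hα
    -- The Hölder constant combines `L`, the constant of the position estimate, and `D^(-α)`, where
    -- `D` is the length of the edge.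
    obtain ⟨L, hL⟩ := exists_lipschitzOnWith_edgeDensity u w hij
    set D : ℝ := 2⁻¹ ^ w.length * ‖p j - p i‖ with hD
    have hD0 : 0 < D := by
      have : 0 < ‖p j - p i‖ := norm_pos_iff.mpr (sub_ne_zero.mpr (hp.injective.ne hij.symm))
      positivity
    set C : ℝ := L * (2 * (((N : ℝ) + 1) / N)) * (D ^ α)⁻¹ with hC
    have hC0 : 0 ≤ C := by positivity
    -- Both ends of the initial edge have equal weight.
    have hρ : (1 : ℝ) ∈ Set.Icc (N : ℝ)⁻¹ N := by
      have : (1 : ℝ) ≤ N := Nat.one_le_cast.mpr hN0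
      exact ⟨inv_le_one_of_one_le₀ this, this⟩
    refine ⟨C.toNNReal, fun x hx y hy => ?_⟩
    have key : dist (δ x) (δ y) ≤ C * dist x y ^ α := by
      obtain ⟨σ, d, hxσ⟩ := exists_dyadic_of_mem_edge hp hx
      obtain ⟨τ, e, hyτ⟩ := exists_dyadic_of_mem_edge hp hy
      have h1 : dist x y = D * |dyadicPoint σ d - dyadicPoint τ e| := by
        rw [Subtype.dist_eq, hxσ, hyτ, dist_edge]
      rw [hδ.eq_vertexDensity hN0 hp hv hxσ, hδ.eq_vertexDensity hN0 hp hv hyτ,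
        vertexDensity_edge u w hij, vertexDensity_edge u w hij, h1,
        Real.mul_rpow hD0.le (abs_nonneg _)]
      have h2 := hL.dist_le_mul _ (fluxPosition_mem_Icc hN0 hρ σ d) _
        (fluxPosition_mem_Icc hN0 hρ τ e)
      have h3 := abs_fluxPosition_sub_le hN0 hα hρ σ τ d e
      rw [Real.dist_eq (fluxPosition _ _ _ _)] at h2
      refine (h2.trans (mul_le_mul_of_nonneg_left h3 L.2)).trans (le_of_eq ?_)
      have h4 : D ^ α ≠ 0 := (Real.rpow_pos_of_pos hD0 α).ne'
      rw [hC]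
      field_simp
    rw [edist_dist, edist_dist, Real.coe_toNNReal α hα0.le,
      ENNReal.ofReal_rpow_of_nonneg dist_nonneg hα0.le]
    change _ ≤ ENNReal.ofReal C * _
    rw [← ENNReal.ofReal_mul hC0]
    exact ENNReal.ofReal_le_ofReal key
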